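/- **Setting.** Let $\mathcal X,\mathcal A,\mathcal Z$ be measurable spaces, with a $\sigma$-finite reference measure $dz$ on $\mathcal Z$. Consider a POMDP with initial belief $b_0$, transition law $p_T(\cdot\mid x,a)$, measurable rewards $r_t(x,a)$, discount $\gamma\in(0,1]$ and horizon $L$ (rewards at times $0,\dots,L$), and two observation densities $p_Z(z\mid x)$ (original) and $q_Z(z\mid x)$ (simplified). A policy $\pi=(\pi_t)$ maps each history $H_t=(b_0,a_0,z_1,\dots,a_{t-1},z_t)$ (measurably) to an action. For $g\in\{p_Z,q_Z\}$ let $g(z_{1:t}\mid a_{0:t-1})=\mathbb E_{x_{0:t}\sim b_0 p_T^{t}}\big[\prod_{i=1}^t g(z_i\mid x_i)\big]$, let $b_t$ be the conditional law of $x_t$ given $H_t$ under $g$, and let $$Q^{\pi,g}_{\mathbf P,L}(b_L,a)=\mathbb E_{x\sim b_L}[r_L(x,a)],\qquad Q^{\pi,g}_{\mathbf P,t}(b_t,a)=\mathbb E_{x\sim b_t}[r_t(x,a)]+\gamma\,\mathbb E_{z}\big[Q^{\pi,g}_{\mathbf P,t+1}(b_{t+1},\pi_{t+1}(H_{t+1}))\big],$$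 where $z$ has density $\iint g(z\mid x')\,p_T(dx'\mid x,a)\,b_t(dx)$ and $H_{t+1}=(H_t,a,z)$. A particle belief is $\bar b=\{(x^j,w^j)\}_{j=1}^C$ with $C\ge1$ particles; it represents the law $\sum_j w^j\delta_{x^j}/\sum_j w^j$. The particle-belief MDP $\mathbf M_{\mathbf P}$ has these as states: given $\bar b_t$ and $a$, it draws $z$ with density $\sum_j \frac{w^j}{\sum_i w^i}\int g(z\mid x')\,p_T(dx'\mid x^j,a)$ and, independently, $x'^j\sim p_T(\cdot\mid x^j,a)$ for $j=1,\dots,C$, and sets $w'^j=w^j g(z\mid x'^j)$ (sequential importance sampling, no resampling). Its reward is $\sum_j w^j r_t(x^j,a)/\sum_j w^j$ (by convention $0$, with value $0$, if all weights vanish), and $Q^{\pi,g}_{\mathbf M_{\mathbf P},t}(\bar b_t,a)$ is its action value: take $a$, then follow $\pi$ on the histories. For a history $H_n$, $n\le L$, with $0<g(z_{1:t}\mid a_{0:t-1})<\infty$ for all $t\le n$, let $x^j_{0:n}\sim b_0p_T^{n}$, $j=1,\dots,C$, be independent trajectories under the actions of $H_n$, and let $\bar b_t=\{(x_t^j,\prod_{i\le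 t}g(z_i\mid x_i^j))\}_j$, $t\le n$. **Assumptions.** 1. $|r_t(x,a)|\le R_{\max,t}$ for $t\le L$. Put $V_{\max,t}=\sum_{i=t}^L\gamma^{i-t}R_{\max,i}$ and $V_{\max}=\max_{0\le t\le L}V_{\max,t}$. 2. For $g\in\{p_Z,q_Z\}$, every $t\le L$ and all $a_{0:t-1}$, $z_{1:t}$: $\ \prod_{i=1}^t g(z_i\mid x_i)\le d_\infty^{\max}\,g(z_{1:t}\mid a_{0:t-1})$ for almost all $x_{0:t}\sim b_0p_T^{t}$ (for $t=0$ this reads $1\le d_\infty^{\max}$). 3. There are random (measurable) state reward estimates $\tilde r_t(x,a)$ from $N_r$ reward samples, independent of the particles, with $\mathbb P(|r_t(x,a)-\tilde r_t(x,a)|\ge\nu)\le\delta_r(\nu,N_r)$ for all $\nu\ge 0$, $N_r$, $t\le L$, $x$, $a$, and $\delta_r(\nu,N_r)\to0$ as $N_r\to\infty$ for every $\nu>0$. Let $\lambda,\nu\ge0$, $N_r\in\mathbb N$ and $$\alpha_L=\lambda,\quad \alpha_t=(1+\gamma)\lambda+\gamma\alpha_{t+1},\qquad \beta_L=2\nu,\quad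 \beta_t=2\nu+\gamma\beta_{t+1},$$ $$k_{\max}=\frac{\lambda}{4V_{\max}d_\infty^{\max}}-\frac1{\sqrt C},\qquad \acute k=\min\Big\{k_{\max},\frac{\lambda}{4\sqrt2\,V_{\max}}\Big\},$$ with $V_{\max}>0$ and $k_{\max}>0$. **Theorem (Generalized PB-MDP convergence).** Let $g\in\{p_Z,q_Z\}$ and let $H_n$ be a history as above. (a) For every policy $\pi$ and all query actions $a_0',\dots,a_n'\in\mathcal A$, with probability at least $1-5(4C)^{L+1}\big(\exp(-C\acute k^2)+\delta_r(\nu,N_r)\big)$, $$\big|Q^{\pi,g}_{\mathbf P,t}(b_t,a'_t)-Q^{\pi,g}_{\mathbf M_{\mathbf P},t}(\bar b_t,a'_t)\big|\le\alpha_t+\beta_t\qquad\text{for all }t\le n.$$ In particular, for every $\pi$, every $t$ and every $a$, the bound at time $t$ holds with at least this probability. (b) If $\mathcal A$ is finite, then with probability at least $1-5(4|\mathcal A|C)^{L+1}\big(\exp(-C\acute k^2)+\delta_r(\nu,N_r)\big)$ the bound $\big|Q^{\pi,g}_{\mathbf P,t}(b_t,a)-Q^{\pi,g}_{\mathbf M_{\mathbf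 P},t}(\bar b_t,a)\big|\le\alpha_t+\beta_t$ holds simultaneously for all policies $\pi$, all $t\le n$ and all $a\in\mathcal A$. Both statements hold when $\mathbf M_{\mathbf P}$ uses the exact reward $r$, and also when it uses the estimate $\tilde r$ in place of $r$, provided that $|\tilde r_t|\le R_{\max,t}$ for $t\le L$. -/

import Mathlib

open MeasureTheory ProbabilityTheory Filter Topology
open scoped NNReal ENNReal

namespace PBMDP

noncomputable section

/-- An observation model: a conditional probability density `dens x z` of the observation `z` in
state `x`, with respect to the reference measure `vol` on the observation space. -/
structure ObsDensity (X : Type*) {Z : Type*} [MeasurableSpace X] [MeasurableSpace Z]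
    (vol : Measure Z) where
  dens : X → Z → ℝ≥0
  measurable_dens : Measurable (fun p : X × Z => dens p.1 p.2)
  lintegral_dens : ∀ x, ∫⁻ z, (dens x z : ℝ≥0∞) ∂vol = 1

/-- The data of a finite-horizon POMDP apart from its observation model, which is a separate
argument below since planning may use the original or a simplified one. The transition model is a
Markov kernel (this includes every transition density). -/
structure POMDP (X A : Type*) [MeasurableSpace X] [MeasurableSpace A] where
  /-- initial belief -/
  b0 : Measure X
  isProb : IsProbabilityMeasure b0
  /-- transition model `p_T(· ∣ x, a)` -/
  T : Kernel (X × A) X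
  isMarkov : IsMarkovKernel T
  /-- time dependent state reward -/
  r : ℕ → X → A → ℝ
  measurable_r : ∀ t, Measurable (fun p : X × A => r t p.1 p.2)
  /-- discount factor -/
  γ : ℝ
  γ_pos : 0 < γ
  γ_le_one : γ ≤ 1
  /-- horizon: rewards are collected at the times `0, …, L` -/
  L : ℕ

/-- A policy maps, at each time `t`, the history `(a_0, z_1), …, (a_{t-1}, z_t)` to an action. -/
structure Policy (A Z : Type*) [MeasurableSpace A] [MeasurableSpace Z] where
  act : (t : ℕ) → (Fin t → A × Z) → A
  measurable_act : ∀ t, Measurable (act t)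

variable {X A Z : Type*} [MeasurableSpace X] [MeasurableSpace A] [MeasurableSpace Z]

/-! Histories are written as sequences `s : ℕ → A × Z` with `s i = (a_i, z_{i+1})`; a notion at
time `t` only reads the entries `s 0, …, s (t-1)`. The history `H_t` is extended by an action `a`
and an observation `z` as `Function.update s t (a, z)`. -/

/-- The action that the policy takes at time `t` after the history `s 0, …, s (t-1)`. -/
def Policy.action (π : Policy A Z) (t : ℕ) (s : ℕ → A × Z) : A := π.act t (fun i : Fin t => s i)

namespace POMDP

variable (M : POMDP X A)

instance : IsProbabilityMeasure M.b0 := M.isProb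
instance : IsMarkovKernel M.T := M.isMarkov

/-- One more step of a state trajectory under action `a` at time `n`. -/
def stepKernel (n : ℕ) (a : A) : Kernel (ℕ → X) X :=
  M.T.comap (fun p => (p n, a)) (by fun_prop)

instance (n : ℕ) (a : A) : IsMarkovKernel (M.stepKernel n a) := by
  unfold stepKernel; infer_instance

/-- The law `b_0 · τ_{1:n}` of the state trajectory `x_0, …, x_n` under the open-loop actions
`a 0, …, a (n-1)`. The coordinates after `n` are dummies (copies of `x_0`). -/
def pathLaw (a : ℕ → A) : ℕ → Measure (ℕ → X)
  | 0 => M.b0.map (fun x _ => x)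
  | n + 1 => ((pathLaw a n) ⊗ₘ (M.stepKernel n (a n))).map
      (fun q => Function.update q.1 (n + 1) q.2)

instance pathLaw_isProb (a : ℕ → A) (n : ℕ) : IsProbabilityMeasure (M.pathLaw a n) := by
  induction n with
  | zero =>
    exact Measure.isProbabilityMeasure_map (by fun_prop)
  | succ n ih =>
    refine Measure.isProbabilityMeasure_map (Measurable.aemeasurable ?_)
    refine measurable_pi_iff.2 fun i => ?_
    by_cases h : i = n + 1
    · subst h; simpa using measurable_snd
    · simp only [Function.update_of_ne h]
      exact (measurable_pi_apply i).comp measurable_fst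

variable {vol : Measure Z} (g : ObsDensity X vol)

/-- Likelihood `∏_{i=1}^t g(z_i ∣ x_i)` of the first `t` observations along a state trajectory.
This is also the sequential importance sampling weight of a particle with this trajectory. -/
def _root_.PBMDP.ObsDensity.lik (s : ℕ → A × Z) (t : ℕ) (p : ℕ → X) : ℝ≥0 :=
  ∏ i ∈ Finset.range t, g.dens (p (i + 1)) (s i).2

/-- Density `g(z_{1:t} ∣ b_0, a_{0:t-1})` of the first `t` observations given the actions. -/
def evidence (s : ℕ → A × Z) (t : ℕ) : ℝ≥0∞ :=
  ∫⁻ p, (g.lik s t p : ℝ≥0∞) ∂(M.pathLaw (fun i => (s i).1) t)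

/-- The belief `b_t`: the conditional law of `x_t` given the history at time `t`. -/
def belief (s : ℕ → A × Z) (t : ℕ) : Measure X :=
  (M.evidence g s t)⁻¹ •
    ((M.pathLaw (fun i => (s i).1) t).withDensity (fun p => (g.lik s t p : ℝ≥0∞))).map
      (fun p => p t)

/-- Law of the next observation when the current state has law `b` and action `a` is taken:
density `z ↦ ∫∫ g(z ∣ x') p_T(dx' ∣ x, a) b(dx)`. -/
def obsLaw (b : Measure X) (a : A) : Measure Z :=
  vol.withDensity (fun z => ∫⁻ x, ∫⁻ x', (g.dens x' z : ℝ≥0∞) ∂(M.T (x, a)) ∂b)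

/-- Action value of policy `π` in the POMDP with observation model `g`, with `k` steps to go:
taking `a` at time `t` after the history `s`, and following `π` afterwards. -/
def QPAux (π : Policy A Z) : ℕ → ℕ → (ℕ → A × Z) → A → ℝ
  | 0, t, s, a => ∫ x, M.r t x a ∂(M.belief g s t)
  | k + 1, t, s, a => ∫ x, M.r t x a ∂(M.belief g s t) +
      M.γ * ∫ z, QPAux π k (t + 1) (Function.update s t (a, z))
        (π.action (t + 1) (Function.update s t (a, z))) ∂(M.obsLaw g (M.belief g s t) a)

/-- The POMDP action value `Q_{P,t}^{π,g}(b_t, a)`, `t ≤ L`, at the belief of the history `s`. -/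
def QP (π : Policy A Z) (t : ℕ) (s : ℕ → A × Z) (a : A) : ℝ :=
  M.QPAux g π (M.L - t) t s a

/-- The discrete law `∑ w_j δ_{x_j} / ∑ w_j` of a particle belief. It is the zero measure in the
degenerate case that all weights vanish. -/
def _root_.PBMDP.particleMeasure {C : ℕ} (x : Fin C → X) (w : Fin C → ℝ≥0) : Measure X :=
  ∑ j, ((w j : ℝ≥0∞) / ∑ i, (w i : ℝ≥0∞)) • Measure.dirac (x j)

/-- Weighted mean `∑ w_j f(x_j) / ∑ w_j` over a particle belief (zero if all weights vanish). -/
def _root_.PBMDP.particleMean {C : ℕ} (x : Fin C → X) (w : Fin C → ℝ≥0) (f : X → ℝ) : ℝ :=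
  (∑ j, (w j : ℝ) * f (x j)) / ∑ j, (w j : ℝ)

/-- Action value of policy `π` in the particle-belief MDP with `C` particles, observation model `g`
and state reward `rew`, with `k` steps to go, at the particle belief `(x, w)`. A transition draws
the observation `z` from the observation law of the particle belief and propagates the particles
independently with `p_T`; the weights are multiplied by the likelihoods of `z`, and there is no
resampling. -/
def QMPAux {C : ℕ} (rew : ℕ → X → A → ℝ) (π : Policy A Z) :
    ℕ → ℕ → (ℕ → A × Z) → (Fin C → X) → (Fin C → ℝ≥0) → A → ℝ
  | 0, t, _, x, w, a => particleMean x w (fun y => rew t y a)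
  | k + 1, t, s, x, w, a => particleMean x w (fun y => rew t y a) +
      M.γ * ∫ q : Z × (Fin C → X), QMPAux rew π k (t + 1) (Function.update s t (a, q.1)) q.2
          (fun j => w j * g.dens (q.2 j) q.1) (π.action (t + 1) (Function.update s t (a, q.1)))
        ∂((M.obsLaw g (particleMeasure x w) a).prod (Measure.pi fun j => M.T (x j, a)))

/-- The particle-belief MDP action value `Q_{M_P,t}^{π,g}(b̄_t, a)`, `t ≤ L`, where `b̄_t` is made of
the time-`t` states of the particle trajectories `x` and their sequential importance sampling
weights for the history `s`. -/
def QMP {C : ℕ} (rew : ℕ → X → A → ℝ) (π : Policy A Z) (t : ℕ) (s : ℕ → A × Z)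
    (x : Fin C → ℕ → X) (a : A) : ℝ :=
  M.QMPAux g rew π (M.L - t) t s (fun j => x j t) (fun j => g.lik s t (x j)) a

/-- The normalized likelihoods are bounded by `d`: for all times `t ≤ L`, actions and observations,
the ratio `∏_{i=1}^t g(z_i ∣ x_i) / g(z_{1:t} ∣ b_0, a_{0:t-1})` is at most `d` for almost all
`x_{0:t} ∼ b_0 · τ_{1:t}`. (Where the denominator is zero, so is the numerator almost surely.) -/
def LikelihoodBound (d : ℝ) : Prop :=
  ∀ t ≤ M.L, ∀ s : ℕ → A × Z, ∀ᵐ p ∂(M.pathLaw (fun i => (s i).1) t),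
    (g.lik s t p : ℝ≥0∞) ≤ ENNReal.ofReal d * M.evidence g s t

/-- `V_{max,t} = ∑_{i=t}^L γ^{i-t} R_{max,i}`. -/
def VmaxAt (Rmax : ℕ → ℝ) (t : ℕ) : ℝ :=
  ∑ i ∈ Finset.Icc t M.L, M.γ ^ (i - t) * Rmax i

/-- `V_max = max_{0 ≤ t ≤ L} V_{max,t}`. -/
def Vmax (Rmax : ℕ → ℝ) : ℝ :=
  (Finset.range (M.L + 1)).sup' ⟨0, by simp⟩ (M.VmaxAt Rmax)

/-- `k_max = λ / (4 V_max d) - 1 / √C`. -/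
def kMax (Rmax : ℕ → ℝ) (d lam : ℝ) (C : ℕ) : ℝ :=
  lam / (4 * M.Vmax Rmax * d) - 1 / √(C : ℝ)

/-- `ḱ = min {k_max, λ / (4 √2 V_max)}`. -/
def kAcute (Rmax : ℕ → ℝ) (d lam : ℝ) (C : ℕ) : ℝ :=
  min (M.kMax Rmax d lam C) (lam / (4 * √2 * M.Vmax Rmax))

end POMDP

end

end PBMDP

/-! ### Hoeffding bounds for empirical means, scalar and in L¹ -/

namespace PBMDP

/-! The argument is importance sampling with weights normalized by the evidence. At a fixed history
the particles come from independent trajectories, their normalized weights have mean one and lie in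
`[0, d]`, and weighted averages are unbiased for expectations under the belief. Hoeffding's
inequality controls the total weight and the mean reward, and an L¹ form of it
(`measure_lintegral_abs_mean_sub_ge_le`) controls the density of the next observation in total
variation. A particle belief with these three properties is `Regular`; if the reward in use is also
close to `r` at the particles, it is `Accurate`. At each fixed history, `jointLaw_not_accurate_le`
bounds the probability of failure.

From an accurate particle belief, replacing the observation law of the true belief by that of the
particles costs at most `λ`, since the values are bounded by `V`. Both recursions then integrate
over the same observation and can be compared inductively. The error can exceed `α + β` only through
later particle beliefs that are not accurate, each costing at most `2V`. The expected number of
their first encounters is `errTail`, and `Accurate.abs_QPAux_sub_QMPAux_le` is the resulting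
inequality, with no probability over the root particles in it yet.

The future histories in the particle-belief MDP are random and depend on the particles, so
concentration at fixed histories does not apply to them directly. A change of measure repairs this.
The observation density of a regular particle belief is at most `2d` times the true predictive
density (`Regular.particleDens_le`), and once `z` is fixed, the root particles propagated by one
step have the law of independent trajectories for the extended history
(`lintegral_particlesAt_succ`). Hence the mean of `errTail` is at most the failure probability at a
fixed history times a sum of powers of `2d|ι|` (`lintegral_errTail_le`). Markov's inequality spends
the slack `λ/10` left by the reward estimate, and a union bound over times and root actions
finishes.

No supremum over policies appears: `errTail` sums over the actions offered by a finite family at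
every node and so dominates every policy choosing among them. The family is `π` alone in (a) and all
constant policies in (b). -/

theorem lintegral_exp_abs_mean_sub_le {E : Type*} [MeasurableSpace E] (μ : Measure E)
    [IsProbabilityMeasure μ] {C : ℕ} (hC : 0 < C) {X : E → ℝ} (hX : Measurable X) {a b : ℝ}
    (hb : ∀ᵐ x ∂μ, X x ∈ Set.Icc a b) (c : ℝ) :
    ∫⁻ x, ENNReal.ofReal (Real.exp (c * |(∑ j, X (x j)) / C - ∫ y, X y ∂μ|))
        ∂(Measure.pi fun _ : Fin C => μ) ≤
      ENNReal.ofReal (2 * Real.exp (c ^ 2 * (b - a) ^ 2 / (8 * C))) := by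
  set P := Measure.pi fun _ : Fin C => μ with hP
  set m := ∫ y, X y ∂μ with hm
  have hCr : (0 : ℝ) < C := by exact_mod_cast hC
  have hsub : ∀ j ∈ (Finset.univ : Finset (Fin C)),
      HasSubgaussianMGF (fun x : Fin C → E => X (x j) - m) ((‖b - a‖₊ / 2) ^ 2) P := by
    intro j _
    have h1 := hasSubgaussianMGF_of_mem_Icc hX.aemeasurable hb
    have h2 : (P.map fun x : Fin C → E => x j) = μ :=
      (measurePreserving_eval (fun _ : Fin C => μ) j).map_eq
    rw [← h2] at h1
    have h3 := HasSubgaussianMGF.of_map (μ := P) (Y := fun x : Fin C → E => x j)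
      (measurable_pi_apply j).aemeasurable h1
    rw [h2] at h3
    exact h3
  have hind : iIndepFun (fun (j : Fin C) (x : Fin C → E) => X (x j) - m) P :=
    iIndepFun_pi (μ := fun _ : Fin C => μ) (X := fun _ y => X y - m)
      (fun _ => (hX.sub_const m).aemeasurable)
  have hsum := HasSubgaussianMGF.sum_of_iIndepFun hind hsub
  set S : (Fin C → E) → ℝ := fun x => ∑ j, (X (x j) - m) with hS
  have hSd : ∀ x, (∑ j, X (x j)) / C - m = S x / C := by
    intro x
    simp only [hS, Finset.sum_sub_distrib, Finset.sum_const, Finset.card_univ, Fintype.card_fin,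
      nsmul_eq_mul]
    field_simp
  have hexp : ∀ t : ℝ, ∫⁻ x, ENNReal.ofReal (Real.exp (t * S x)) ∂P ≤
      ENNReal.ofReal (Real.exp ((C * (b - a) ^ 2 / 4) * t ^ 2 / 2)) := by
    intro t
    rw [← ofReal_integral_eq_lintegral_ofReal (hsum.integrable_exp_mul t)
      (ae_of_all _ fun _ => (Real.exp_pos _).le)]
    refine ENNReal.ofReal_le_ofReal ((hsum.mgf_le t).trans (le_of_eq ?_))
    congr 2
    simp only [Finset.sum_const, Finset.card_univ, Fintype.card_fin, nsmul_eq_mul]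
    push_cast
    rw [div_pow, Real.norm_eq_abs, sq_abs]
    ring
  -- The exponential of `c|v|` is at most the sum of the exponentials of `cv` and `-cv`; this is the
  -- factor 2.
  calc ∫⁻ x, ENNReal.ofReal (Real.exp (c * |(∑ j, X (x j)) / C - m|)) ∂P
      ≤ ∫⁻ x, (ENNReal.ofReal (Real.exp ((c / C) * S x)) +
          ENNReal.ofReal (Real.exp ((-(c / C)) * S x))) ∂P := by
        refine lintegral_mono fun x => ?_
        rw [← ENNReal.ofReal_add (Real.exp_pos _).le (Real.exp_pos _).le, hSd]
        refine ENNReal.ofReal_le_ofReal ?_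
        rcases abs_choice (S x / C) with h | h <;> rw [h]
        · have : c * (S x / C) = c / C * S x := by ring
          rw [this]; linarith [Real.exp_pos (-(c / C) * S x)]
        · have : c * -(S x / C) = -(c / C) * S x := by ring
          rw [this]; linarith [Real.exp_pos ((c / C) * S x)]
    _ ≤ ENNReal.ofReal (Real.exp ((C * (b - a) ^ 2 / 4) * (c / C) ^ 2 / 2)) +
        ENNReal.ofReal (Real.exp ((C * (b - a) ^ 2 / 4) * (-(c / C)) ^ 2 / 2)) := by
        rw [lintegral_add_left (by fun_prop)]
        exact add_le_add (hexp _) (hexp _)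
    _ = ENNReal.ofReal (2 * Real.exp (c ^ 2 * (b - a) ^ 2 / (8 * C))) := by
        rw [← ENNReal.ofReal_add (Real.exp_pos _).le (Real.exp_pos _).le, neg_sq, ← two_mul]
        congr 3
        field_simp
        ring

-- Since `p` is a probability density, Jensen's inequality bounds the exponential of `s ∫ S` by the
-- `p`-average of the exponential of `s S / p`. After exchanging the integrals, the scalar
-- exponential moment bound applies for each `y` to a variable of range `l` (after division by `p
-- y`). So the L¹ deviation has the scalar Hoeffding tail, whatever the size of the space of `y`.
set_option maxHeartbeats 1600000 in
theorem measure_lintegral_abs_mean_sub_ge_le {E Y : Type*} [MeasurableSpace E]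
    [MeasurableSpace Y] (μ : Measure E) [IsProbabilityMeasure μ] (vol : Measure Y) [SFinite vol]
    {C : ℕ} (hC : 0 < C) {h : E → Y → ℝ} (hh : Measurable (Function.uncurry h))
    {p A m : Y → ℝ} (hpm : Measurable p) (hmm : Measurable m) (hp0 : ∀ y, 0 ≤ p y)
    (hp : ∫⁻ y, ENNReal.ofReal (p y) ∂vol = 1) {l : ℝ} (hl : 0 < l)
    (hb : ∀ᵐ y ∂vol, ∀ᵐ x ∂μ, h x y ∈ Set.Icc (A y) (A y + l * p y))
    (hmean : ∀ᵐ y ∂vol, ∫ x, h x y ∂μ = m y) {ε : ℝ} (hε : 0 ≤ ε) :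
    (Measure.pi fun _ : Fin C => μ)
        {x | ENNReal.ofReal ε ≤ ∫⁻ y, ENNReal.ofReal |(∑ j, h (x j) y) / C - m y| ∂vol} ≤
      ENNReal.ofReal (2 * Real.exp (-(2 * C * ε ^ 2 / l ^ 2))) := by
  set P := Measure.pi fun _ : Fin C => μ with hP
  have hCr : (0 : ℝ) < C := by exact_mod_cast hC
  -- The minimizer of the Chernoff exponent `s²l²/(8C) - sε`, whose minimum is `-2Cε²/l²`.
  set s : ℝ := 4 * C * ε / l ^ 2 with hs
  have hs0 : 0 ≤ s := by positivity
  set S : (Fin C → E) → Y → ℝ := fun x y => |(∑ j, h (x j) y) / C - m y| with hS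
  have hhj : ∀ j, Measurable fun q : (Fin C → E) × Y => h (q.1 j) q.2 := fun j =>
    hh.comp (Measurable.prodMk ((measurable_pi_apply j).comp measurable_fst) measurable_snd)
  have hSm : Measurable (Function.uncurry S) := by
    have : Measurable fun q : (Fin C → E) × Y => |(∑ j, h (q.1 j) q.2) / C - m q.2| := by
      have := fun j => hhj j
      fun_prop
    exact this
  have hS1 : ∀ x, Measurable (S x) := fun x => hSm.comp measurable_prodMk_left
  have hS2 : ∀ y, Measurable (fun x => S x y) := fun y => hSm.comp measurable_prodMk_right
  -- Where `p` vanishes the quotient `S / p` is meaningless. The infinite weight there dominates any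
  -- positive `S`, and it costs nothing: the interval for `h` is a single point, so `S = 0` almost
  -- surely.
  set Ψ : (Fin C → E) → Y → ℝ≥0∞ := fun x y =>
    if p y = 0 then ∞ * ENNReal.ofReal (S x y)
    else ENNReal.ofReal (p y) * ENNReal.ofReal (Real.exp (s * (S x y / p y))) with hΨ
  have hΨm : Measurable (Function.uncurry Ψ) := by
    refine Measurable.ite (f := fun q : (Fin C → E) × Y => ∞ * ENNReal.ofReal (S q.1 q.2))
      (g := fun q : (Fin C → E) × Y => ENNReal.ofReal (p q.2) *
        ENNReal.ofReal (Real.exp (s * (S q.1 q.2 / p q.2)))) ?_ ?_ ?_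
    · exact (hpm.comp measurable_snd) (measurableSet_singleton 0)
    · exact (ENNReal.measurable_ofReal.comp hSm).const_mul _
    · have : Measurable fun q : (Fin C → E) × Y => S q.1 q.2 := hSm
      fun_prop
  -- pointwise tangent line bound
  have htan : ∀ x y, ENNReal.ofReal (Real.exp (s * ε)) * ENNReal.ofReal (p y) +
      ENNReal.ofReal (Real.exp (s * ε) * s) * ENNReal.ofReal (S x y) ≤
      Ψ x y + ENNReal.ofReal (Real.exp (s * ε) * s * ε) * ENNReal.ofReal (p y) := by
    intro x y
    have hSn : 0 ≤ S x y := abs_nonneg _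
    by_cases hpy : p y = 0
    · simp only [hΨ, hpy, if_true, ENNReal.ofReal_zero, mul_zero, zero_add, add_zero]
      gcongr
      exact le_top
    · have hpp : 0 < p y := lt_of_le_of_ne (hp0 y) (Ne.symm hpy)
      simp only [hΨ, hpy, if_false]
      rw [← ENNReal.ofReal_mul (by positivity), ← ENNReal.ofReal_mul (by positivity),
        ← ENNReal.ofReal_mul (by positivity), ← ENNReal.ofReal_mul (by positivity),
        ← ENNReal.ofReal_add (by positivity) (by positivity),
        ← ENNReal.ofReal_add (by positivity) (by positivity)]
      refine ENNReal.ofReal_le_ofReal ?_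
      have h1 : Real.exp (s * (S x y / p y)) =
          Real.exp (s * ε) * Real.exp (s * (S x y / p y) - s * ε) := by
        rw [← Real.exp_add]; congr 1; ring
      have h2 := Real.add_one_le_exp (s * (S x y / p y) - s * ε)
      have h3 : p y * (Real.exp (s * ε) * (s * (S x y / p y) - s * ε + 1)) ≤
          p y * Real.exp (s * (S x y / p y)) := by
        rw [h1]; gcongr
      have h4 : p y * (Real.exp (s * ε) * (s * (S x y / p y) - s * ε + 1)) =
        Real.exp (s * ε) * p y + Real.exp (s * ε) * s * S x y
          - Real.exp (s * ε) * s * ε * p y := by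
        field_simp; ring
      linarith
  -- Jensen's inequality by integrating the tangent at `ε`: the linear term is at least `s ε` times
  -- its coefficient, and this cancels. No integrability of `S` is needed.
  have hint : ∀ x, ENNReal.ofReal ε ≤ ∫⁻ y, ENNReal.ofReal (S x y) ∂vol →
      ENNReal.ofReal (Real.exp (s * ε)) ≤ ∫⁻ y, Ψ x y ∂vol := by
    intro x hx
    have h1 := lintegral_mono (μ := vol) (htan x)
    rw [lintegral_add_left (by fun_prop), lintegral_add_right _ (by fun_prop),
      lintegral_const_mul _ (by fun_prop),
      lintegral_const_mul _ (by have := hS1 x; fun_prop), lintegral_const_mul _ (by fun_prop), hp,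
      mul_one, mul_one] at h1
    have h2 : ENNReal.ofReal (Real.exp (s * ε) * s * ε) ≤
        ENNReal.ofReal (Real.exp (s * ε) * s) * ∫⁻ y, ENNReal.ofReal (S x y) ∂vol := by
      rw [ENNReal.ofReal_mul (by positivity)]
      gcongr
    have h3 := (add_le_add_right h2 (ENNReal.ofReal (Real.exp (s * ε)))).trans h1
    exact (ENNReal.add_le_add_iff_right ENNReal.ofReal_ne_top).1 h3
  have hΨint : ∀ᵐ y ∂vol, ∫⁻ x, Ψ x y ∂P ≤
      ENNReal.ofReal (p y) * ENNReal.ofReal (2 * Real.exp (s ^ 2 * l ^ 2 / (8 * C))) := by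
    filter_upwards [hb, hmean] with y hby hmy
    have hhy : Measurable fun x => h x y := hh.comp measurable_prodMk_right
    by_cases hpy : p y = 0
    · have hc : ∀ᵐ x ∂μ, h x y = A y := by
        filter_upwards [hby] with x hx
        rw [hpy] at hx
        exact le_antisymm (by simpa using hx.2) hx.1
      have hmA : m y = A y := by
        rw [← hmy, integral_congr_ae hc]; simp
      have hall : ∀ᵐ x ∂P, ∀ j, h (x j) y = A y := by
        rw [ae_all_iff]
        intro j
        exact (measurePreserving_eval (fun _ : Fin C => μ) j).quasiMeasurePreserving.ae hc
      have h0 : ∀ᵐ x ∂P, Ψ x y = 0 := by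
        filter_upwards [hall] with x hx
        simp only [hΨ, hpy, if_true, hS, hx, hmA]
        simp [hC.ne']
      rw [lintegral_congr_ae h0]
      simp
    · have hpp : 0 < p y := lt_of_le_of_ne (hp0 y) (Ne.symm hpy)
      have h1 := lintegral_exp_abs_mean_sub_le μ hC hhy hby (s / p y)
      simp only [hΨ, hpy, if_false]
      rw [lintegral_const_mul _ (by have := hS2 y; fun_prop)]
      gcongr
      refine le_trans (le_of_eq ?_) (h1.trans (le_of_eq ?_))
      · refine lintegral_congr fun x => ?_
        rw [hmy]
        congr 2
        simp only [hS]; ring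
      · congr 3
        field_simp
        ring
  have hPΨ : ∫⁻ x, ∫⁻ y, Ψ x y ∂vol ∂P ≤
      ENNReal.ofReal (2 * Real.exp (s ^ 2 * l ^ 2 / (8 * C))) := by
    rw [lintegral_lintegral_swap hΨm.aemeasurable]
    refine (lintegral_mono_ae hΨint).trans ?_
    rw [lintegral_mul_const _ (by fun_prop), hp, one_mul]
  have hmk : P {x | ENNReal.ofReal ε ≤ ∫⁻ y, ENNReal.ofReal (S x y) ∂vol} ≤
      (∫⁻ x, ∫⁻ y, Ψ x y ∂vol ∂P) / ENNReal.ofReal (Real.exp (s * ε)) := by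
    refine (measure_mono ?_).trans (meas_ge_le_lintegral_div
      (f := fun x => ∫⁻ y, Ψ x y ∂vol) (Measurable.lintegral_prod_right hΨm).aemeasurable
      (by simp [Real.exp_pos]) ENNReal.ofReal_ne_top)
    exact fun x hx => hint x hx
  refine hmk.trans ((ENNReal.div_le_div_right hPΨ _).trans (le_of_eq ?_))
  rw [← ENNReal.ofReal_div_of_pos (Real.exp_pos _), mul_div_assoc, ← Real.exp_sub]
  congr 3
  simp only [hs]
  field_simp
  ring

/-! ### Independent copies of a kernel -/

/-- The product kernel `x ↦ ⨂ⱼ κ (x j)`. -/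
noncomputable def piKernel {E F : Type*} [MeasurableSpace E] [MeasurableSpace F] (κ : Kernel E F)
    [IsMarkovKernel κ] (C : ℕ) : Kernel (Fin C → E) (Fin C → F) where
  toFun x := Measure.pi fun j => κ (x j)
  measurable' := by
    refine Measurable.measure_of_isPiSystem_of_isProbabilityMeasure generateFrom_pi.symm
      isPiSystem_pi ?_
    rintro _ ⟨s, hs, rfl⟩
    simp only [Measure.pi_pi]
    refine Finset.measurable_prod _ fun j _ => ?_
    exact (κ.measurable_coe (hs j (Set.mem_univ j))).comp (measurable_pi_apply j)

theorem piKernel_apply {E F : Type*} [MeasurableSpace E] [MeasurableSpace F] (κ : Kernel E F)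
    [IsMarkovKernel κ] (C : ℕ) (x : Fin C → E) :
    piKernel κ C x = Measure.pi fun j => κ (x j) := rfl

instance {E F : Type*} [MeasurableSpace E] [MeasurableSpace F] (κ : Kernel E F)
    [IsMarkovKernel κ] (C : ℕ) : IsMarkovKernel (piKernel κ C) :=
  ⟨fun x => by rw [piKernel_apply]; infer_instance⟩

/-- Both measures agree on boxes, where the left side factorizes by definition and the right side by
independence of the coordinates. This lets `C` independent trajectories be extended all at once. -/
theorem pi_compProd_eq_map {E F : Type*} [MeasurableSpace E] [MeasurableSpace F] (μ : Measure E)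
    [IsProbabilityMeasure μ] (κ : Kernel E F) [IsMarkovKernel κ] (C : ℕ) :
    (Measure.pi fun _ : Fin C => μ ⊗ₘ κ) =
      ((Measure.pi fun _ : Fin C => μ) ⊗ₘ piKernel κ C).map (fun q j => (q.1 j, q.2 j)) := by
  have hmeas : Measurable fun q : (Fin C → E) × (Fin C → F) => fun j => (q.1 j, q.2 j) := by
    fun_prop
  refine (Measure.pi_eq fun s hs => ?_)
  rw [Measure.map_apply hmeas (MeasurableSet.univ_pi hs),
    Measure.compProd_apply (hmeas (MeasurableSet.univ_pi hs))]
  have h1 : ∀ x : Fin C → E, piKernel κ C x (Prod.mk x ⁻¹'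
      ((fun q : (Fin C → E) × (Fin C → F) => fun j => (q.1 j, q.2 j)) ⁻¹' Set.univ.pi s)) =
      ∏ j, κ (x j) (Prod.mk (x j) ⁻¹' s j) := by
    intro x
    rw [piKernel_apply, ← Measure.pi_pi]
    congr 1
  simp only [h1]
  have h2 := lintegral_prod_eq_prod_lintegral_of_indepFun (μ := Measure.pi fun _ : Fin C => μ)
    Finset.univ (fun (j : Fin C) (x : Fin C → E) => κ (x j) (Prod.mk (x j) ⁻¹' s j))
    (iIndepFun_pi (μ := fun _ : Fin C => μ) (X := fun j e => κ e (Prod.mk e ⁻¹' s j))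
      (fun j => (Kernel.measurable_kernel_prodMk_left (hs j)).aemeasurable))
    (fun j => (Kernel.measurable_kernel_prodMk_left (hs j)).comp (measurable_pi_apply j))
  rw [h2]
  refine Finset.prod_congr rfl fun j _ => ?_
  rw [Measure.compProd_apply (hs j)]
  exact (measurePreserving_eval (fun _ : Fin C => μ) j).lintegral_comp
    (Kernel.measurable_kernel_prodMk_left (hs j))

/-! ### Joint measurability of beliefs, observation laws and action values -/

noncomputable section

theorem Policy.measurable_action {A Z : Type*} [MeasurableSpace A] [MeasurableSpace Z]
    (π : Policy A Z) (t : ℕ) : Measurable (π.action t) :=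
  (π.measurable_act t).comp (by fun_prop)

theorem measurable_update_snd {ι S E : Type*} [DecidableEq ι] [MeasurableSpace S]
    [MeasurableSpace E] {f : S → ι → E} {e : S → E} (hf : Measurable f) (he : Measurable e)
    (i : ι) : Measurable fun q => Function.update (f q) i (e q) := by
  refine measurable_pi_iff.2 fun j => ?_
  by_cases h : j = i
  · subst h; simpa using he
  · simp only [Function.update_of_ne h]
    exact (measurable_pi_apply j).comp hf

theorem abs_integral_le_of_measure_univ_le_one {E : Type*} [MeasurableSpace E] {μ : Measure E}
    (hμ : μ Set.univ ≤ 1) {f : E → ℝ} {c : ℝ} (hf : ∀ x, |f x| ≤ c) (hc : 0 ≤ c) :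
    |∫ x, f x ∂μ| ≤ c := by
  have : IsFiniteMeasure μ := ⟨hμ.trans_lt ENNReal.one_lt_top⟩
  have h1 := norm_integral_le_of_norm_le_const (μ := μ) (f := f) (C := c) (ae_of_all _ hf)
  have h2 : μ.real Set.univ ≤ 1 := by
    simpa [Measure.real] using ENNReal.toReal_mono ENNReal.one_ne_top hμ
  rw [Real.norm_eq_abs] at h1
  nlinarith

namespace POMDP

variable {X A Z : Type*} [MeasurableSpace X] [MeasurableSpace A] [MeasurableSpace Z]
variable (M : POMDP X A) {vol : Measure Z} (g : ObsDensity X vol)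

/-- The law of the state trajectory as a kernel in the actions. -/
def pathKernel : ℕ → Kernel (ℕ → A) (ℕ → X)
  | 0 => Kernel.const _ (M.b0.map fun x _ => x)
  | n + 1 => ((pathKernel n) ⊗ₖ
      (M.T.comap (fun q : (ℕ → A) × (ℕ → X) => (q.2 n, q.1 n)) (by fun_prop))).map
      (fun q => Function.update q.1 (n + 1) q.2)

theorem measurable_update_pair (n : ℕ) :
    Measurable fun q : (ℕ → X) × X => Function.update q.1 n q.2 :=
  measurable_update_snd measurable_fst measurable_snd n

instance (n : ℕ) : IsMarkovKernel (M.pathKernel n) := by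
  induction n with
  | zero =>
    have : IsProbabilityMeasure (M.b0.map fun x (_ : ℕ) => x) :=
      Measure.isProbabilityMeasure_map (by fun_prop)
    unfold pathKernel; infer_instance
  | succ n ih =>
    unfold pathKernel
    exact Kernel.IsMarkovKernel.map _ (measurable_update_pair _)

theorem pathKernel_apply (n : ℕ) (a : ℕ → A) : M.pathKernel n a = M.pathLaw a n := by
  induction n with
  | zero => simp [pathKernel, pathLaw]
  | succ n ih =>
    rw [pathKernel, Kernel.map_apply _ (measurable_update_pair _), pathLaw,
      Kernel.compProd_apply_eq_compProd_sectR, ih]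
    rfl

theorem measurable_lintegral_pathLaw {S : Type*} [MeasurableSpace S] {f : S → (ℕ → X) → ℝ≥0∞}
    (hf : Measurable (Function.uncurry f)) {a : S → ℕ → A} (ha : Measurable a) (t : ℕ) :
    Measurable fun q => ∫⁻ p, f q p ∂(M.pathLaw (a q) t) := by
  have := hf.lintegral_kernel_prod_right (κ := (M.pathKernel t).comap a ha)
  simpa only [Kernel.comap_apply, pathKernel_apply] using this

theorem measurable_lik (t : ℕ) :
    Measurable fun q : (ℕ → A × Z) × (ℕ → X) => g.lik q.1 t q.2 := by
  unfold ObsDensity.lik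
  refine Finset.measurable_prod _ fun i _ => ?_
  exact g.measurable_dens.comp (by fun_prop : Measurable
    fun q : (ℕ → A × Z) × (ℕ → X) => (q.2 (i + 1), (q.1 i).2))

theorem measurable_evidence (t : ℕ) : Measurable fun s => M.evidence g s t := by
  unfold evidence
  refine M.measurable_lintegral_pathLaw ?_ (by fun_prop) t
  exact (measurable_lik g t).coe_nnreal_ennreal

theorem lintegral_belief (s : ℕ → A × Z) (t : ℕ) {f : X → ℝ≥0∞} (hf : Measurable f) :
    ∫⁻ x, f x ∂(M.belief g s t) = (M.evidence g s t)⁻¹ *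
      ∫⁻ p, (g.lik s t p : ℝ≥0∞) * f (p t) ∂(M.pathLaw (fun i => (s i).1) t) := by
  rw [belief, lintegral_smul_measure, lintegral_map hf (by fun_prop),
    lintegral_withDensity_eq_lintegral_mul]
  · rfl
  · exact ((measurable_lik g t).comp measurable_prodMk_left).coe_nnreal_ennreal
  · exact hf.comp (measurable_pi_apply t)

/-- When the evidence is `0` or `∞`, the conventions of `ℝ≥0∞` make the total mass `0`. Thus kernels
and value bounds need no restriction to histories at which the belief is defined. -/
theorem belief_univ_le_one (s : ℕ → A × Z) (t : ℕ) : M.belief g s t Set.univ ≤ 1 := by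
  have h := M.lintegral_belief g s t (f := fun _ => 1) measurable_const
  simp only [lintegral_const, one_mul, mul_one] at h
  rw [h]
  exact ENNReal.inv_mul_le_one _

instance (s : ℕ → A × Z) (t : ℕ) : IsFiniteMeasure (M.belief g s t) :=
  ⟨(M.belief_univ_le_one g s t).trans_lt ENNReal.one_lt_top⟩

/-- The belief as a kernel in the history. -/
def beliefKernel (t : ℕ) : Kernel (ℕ → A × Z) X where
  toFun s := M.belief g s t
  measurable' := by
    refine Measure.measurable_of_measurable_coe _ fun S hS => ?_
    have h : ∀ s, M.belief g s t S = (M.evidence g s t)⁻¹ *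
        ∫⁻ p, (g.lik s t p : ℝ≥0∞) * S.indicator 1 (p t) ∂(M.pathLaw (fun i => (s i).1) t) := by
      intro s
      rw [← M.lintegral_belief g s t (measurable_one.indicator hS), lintegral_indicator_one hS]
    simp only [h]
    refine (M.measurable_evidence g t).inv.mul (M.measurable_lintegral_pathLaw ?_ (by fun_prop) t)
    refine (measurable_lik g t).coe_nnreal_ennreal.mul ?_
    exact (measurable_one.indicator hS).comp
      (by fun_prop : Measurable fun q : (ℕ → A × Z) × (ℕ → X) => q.2 t)

instance (t : ℕ) : IsFiniteKernel (M.beliefKernel g t) :=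
  ⟨1, ENNReal.one_lt_top, fun s => M.belief_univ_le_one g s t⟩

/-- The density of the next observation, after action `a` in state `x`. -/
def nextDens (x : X) (a : A) (z : Z) : ℝ≥0∞ := ∫⁻ x', (g.dens x' z : ℝ≥0∞) ∂(M.T (x, a))

theorem measurable_nextDens {S : Type*} [MeasurableSpace S] {x : S → X} {a : S → A} {z : S → Z}
    (hx : Measurable x) (ha : Measurable a) (hz : Measurable z) :
    Measurable fun q => M.nextDens g (x q) (a q) (z q) := by
  have h : Measurable (Function.uncurry fun (q : S) (x' : X) => (g.dens x' (z q) : ℝ≥0∞)) :=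
    (g.measurable_dens.comp
      (by fun_prop : Measurable fun q : S × X => (q.2, z q.1))).coe_nnreal_ennreal
  exact h.lintegral_kernel_prod_right (κ := M.T.comap (fun q => (x q, a q)) (by fun_prop))

theorem obsLaw_eq (b : Measure X) (a : A) :
    M.obsLaw g b a = vol.withDensity fun z => ∫⁻ x, M.nextDens g x a z ∂b := rfl

theorem measurable_lintegral_nextDens {S : Type*} [MeasurableSpace S] (κ : Kernel S X)
    [IsSFiniteKernel κ] {a : S → A} {z : S → Z} (ha : Measurable a) (hz : Measurable z) :
    Measurable fun q => ∫⁻ x, M.nextDens g x (a q) (z q) ∂(κ q) := by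
  refine Measurable.lintegral_kernel_prod_right (f := fun q x => M.nextDens g x (a q) (z q)) ?_
  exact M.measurable_nextDens g (by fun_prop) (by fun_prop) (by fun_prop)

theorem measurable_lintegral_nextDens_right (b : Measure X) [SFinite b] (a : A) :
    Measurable fun z => ∫⁻ x, M.nextDens g x a z ∂b :=
  M.measurable_lintegral_nextDens g (Kernel.const Z b) measurable_const measurable_id

theorem lintegral_nextDens_vol [SFinite vol] (x : X) (a : A) :
    ∫⁻ z, M.nextDens g x a z ∂vol = 1 := by
  unfold nextDens
  rw [lintegral_lintegral_swap]
  · simp [g.lintegral_dens]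
  · exact (g.measurable_dens.comp measurable_swap).coe_nnreal_ennreal.aemeasurable

theorem lintegral_lintegral_nextDens [SFinite vol] (b : Measure X) [SFinite b] (a : A) :
    ∫⁻ z, ∫⁻ x, M.nextDens g x a z ∂b ∂vol = b Set.univ := by
  rw [lintegral_lintegral_swap]
  · simp [M.lintegral_nextDens_vol g]
  · exact (M.measurable_nextDens g measurable_snd measurable_const measurable_fst).aemeasurable

theorem obsLaw_univ [SFinite vol] (b : Measure X) [SFinite b] (a : A) :
    M.obsLaw g b a Set.univ = b Set.univ := by
  rw [obsLaw_eq, withDensity_apply _ MeasurableSet.univ, Measure.restrict_univ,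
    M.lintegral_lintegral_nextDens g]

/-- The law of the next observation as a kernel. -/
def obsKernel [SFinite vol] {S : Type*} [MeasurableSpace S] (κ : Kernel S X) [IsFiniteKernel κ]
    (a : S → A) (ha : Measurable a) : Kernel S Z where
  toFun q := M.obsLaw g (κ q) (a q)
  measurable' := by
    refine Measure.measurable_of_measurable_coe _ fun E hE => ?_
    simp only [obsLaw_eq, withDensity_apply _ hE]
    refine Measurable.lintegral_prod_right
      (f := fun (q : S) (z : Z) => ∫⁻ x, M.nextDens g x (a q) z ∂(κ q)) ?_
    exact M.measurable_lintegral_nextDens g (κ.comap (Prod.fst : S × Z → S) measurable_fst)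
      (ha.comp measurable_fst) measurable_snd

instance [SFinite vol] {S : Type*} [MeasurableSpace S] (κ : Kernel S X) [IsFiniteKernel κ]
    (a : S → A) (ha : Measurable a) : IsFiniteKernel (M.obsKernel g κ a ha) :=
  ⟨κ.bound, Kernel.bound_lt_top κ, fun q => by
    change M.obsLaw g (κ q) (a q) Set.univ ≤ _
    rw [M.obsLaw_univ g]; exact Kernel.measure_le_bound κ q _⟩

theorem measurable_integral_r {S : Type*} [MeasurableSpace S] (κ : Kernel S X) [IsFiniteKernel κ]
    {r : S → X → ℝ} (hr : Measurable (Function.uncurry r)) :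
    Measurable fun q => ∫ x, r q x ∂(κ q) :=
  (hr.stronglyMeasurable.integral_kernel_prod_right (κ := κ)).measurable

theorem measurable_integral_belief {S : Type*} [MeasurableSpace S] (t : ℕ) {s : S → ℕ → A × Z}
    {a : S → A} (hs : Measurable s) (ha : Measurable a) :
    Measurable fun q => ∫ x, M.r t x (a q) ∂(M.belief g (s q) t) := by
  refine measurable_integral_r ((M.beliefKernel g t).comap s hs)
    (r := fun q x => M.r t x (a q)) ?_
  exact (M.measurable_r t).comp (by fun_prop : Measurable fun q : S × X => (q.2, a q.1))

theorem measurable_QPAux [SFinite vol] (π : Policy A Z) (k t : ℕ) :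
    Measurable fun q : (ℕ → A × Z) × A => M.QPAux g π k t q.1 q.2 := by
  induction k generalizing t with
  | zero => exact M.measurable_integral_belief g t measurable_fst measurable_snd
  | succ k ih =>
    simp only [QPAux]
    refine (M.measurable_integral_belief g t measurable_fst measurable_snd).add (Measurable.const_mul ?_ _)
    refine measurable_integral_r (X := Z) (M.obsKernel g ((M.beliefKernel g t).comap
      (Prod.fst : (ℕ → A × Z) × A → _) measurable_fst) Prod.snd measurable_snd)
      (r := fun q z => M.QPAux g π k (t + 1) (Function.update q.1 t (q.2, z))
        (π.action (t + 1) (Function.update q.1 t (q.2, z)))) ?_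
    have hu : Measurable fun q : ((ℕ → A × Z) × A) × Z =>
        Function.update q.1.1 t (q.1.2, q.2) :=
      measurable_update_snd (by fun_prop) (by fun_prop) t
    exact (ih (t + 1)).comp (hu.prodMk ((π.measurable_action _).comp hu))

theorem sum_div_sum_le_one {C : ℕ} (w : Fin C → ℝ≥0) :
    ∑ j, (w j : ℝ≥0∞) / ∑ i, (w i : ℝ≥0∞) ≤ 1 := by
  simp only [div_eq_mul_inv, ← Finset.sum_mul]
  exact ENNReal.mul_inv_le_one _

theorem particleMeasure_univ_le_one {C : ℕ} (x : Fin C → X) (w : Fin C → ℝ≥0) :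
    particleMeasure x w Set.univ ≤ 1 := by
  simpa [particleMeasure, Measure.finsetSum_apply] using sum_div_sum_le_one w

instance {C : ℕ} (x : Fin C → X) (w : Fin C → ℝ≥0) : IsFiniteMeasure (particleMeasure x w) :=
  ⟨(particleMeasure_univ_le_one x w).trans_lt ENNReal.one_lt_top⟩

/-- The law represented by a particle belief, as a kernel. -/
def particleKernel (X : Type*) [MeasurableSpace X] (C : ℕ) :
    Kernel ((Fin C → X) × (Fin C → ℝ≥0)) X where
  toFun q := particleMeasure q.1 q.2
  measurable' := by
    refine Measure.measurable_of_measurable_coe _ fun E hE => ?_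
    simp only [particleMeasure, Measure.finsetSum_apply, Measure.smul_apply,
      Measure.dirac_apply' _ hE, smul_eq_mul]
    refine Finset.measurable_sum _ fun j _ => Measurable.mul ?_ ?_
    · fun_prop
    · exact (measurable_one.indicator hE).comp
        (by fun_prop : Measurable fun q : (Fin C → X) × (Fin C → ℝ≥0) => q.1 j)

instance (C : ℕ) : IsFiniteKernel (particleKernel X C) :=
  ⟨1, ENNReal.one_lt_top, fun q => particleMeasure_univ_le_one q.1 q.2⟩

theorem measurable_particleMean {S : Type*} [MeasurableSpace S] {C : ℕ} {x : S → Fin C → X}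
    {w : S → Fin C → ℝ≥0} {f : S → X → ℝ} (hx : Measurable x) (hw : Measurable w)
    (hf : Measurable (Function.uncurry f)) :
    Measurable fun q => particleMean (x q) (w q) (f q) := by
  unfold particleMean
  have h : ∀ j, Measurable fun q => f q (x q j) := fun j =>
    hf.comp (measurable_id.prodMk ((measurable_pi_apply j).comp hx))
  have h' : ∀ j, Measurable fun q => ((w q j : ℝ≥0) : ℝ) := fun j =>
    ((measurable_pi_apply j).comp hw).coe_nnreal_real
  exact (Finset.measurable_sum _ fun j _ => (h' j).mul (h j)).div
    (Finset.measurable_sum _ fun j _ => h' j)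

/-- The transition kernel of the particle-belief MDP: the next observation and the next states of
the particles. -/
def particleStep [SFinite vol] {S : Type*} [MeasurableSpace S] {C : ℕ} (x : S → Fin C → X)
    (w : S → Fin C → ℝ≥0) (a : S → A) (hx : Measurable x) (hw : Measurable w)
    (ha : Measurable a) : Kernel S (Z × (Fin C → X)) :=
  (M.obsKernel g ((particleKernel X C).comap (fun q => (x q, w q)) (hx.prodMk hw)) a ha) ×ₖ
    ((piKernel M.T C).comap (fun q j => (x q j, a q)) (by fun_prop))

theorem particleStep_apply [SFinite vol] {S : Type*} [MeasurableSpace S] {C : ℕ}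
    (x : S → Fin C → X) (w : S → Fin C → ℝ≥0) (a : S → A) (hx : Measurable x) (hw : Measurable w)
    (ha : Measurable a) (q : S) :
    M.particleStep g x w a hx hw ha q =
      (M.obsLaw g (particleMeasure (x q) (w q)) (a q)).prod
        (Measure.pi fun j => M.T (x q j, a q)) := by
  rw [particleStep, Kernel.prod_apply]
  rfl

instance [SFinite vol] {S : Type*} [MeasurableSpace S] {C : ℕ}
    (x : S → Fin C → X) (w : S → Fin C → ℝ≥0) (a : S → A) (hx : Measurable x) (hw : Measurable w)
    (ha : Measurable a) : IsFiniteKernel (M.particleStep g x w a hx hw ha) := by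
  unfold particleStep; infer_instance

theorem measurable_QMPAux [SFinite vol] {C : ℕ} {rew : ℕ → X → A → ℝ}
    (hrew : ∀ t, Measurable fun q : X × A => rew t q.1 q.2) (π : Policy A Z) (k t : ℕ) :
    Measurable fun q : (ℕ → A × Z) × (Fin C → X) × (Fin C → ℝ≥0) × A =>
      M.QMPAux g rew π k t q.1 q.2.1 q.2.2.1 q.2.2.2 := by
  have hpm : ∀ t, Measurable fun q : (ℕ → A × Z) × (Fin C → X) × (Fin C → ℝ≥0) × A =>
      particleMean q.2.1 q.2.2.1 fun y => rew t y q.2.2.2 := fun t =>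
    measurable_particleMean (f := fun q : (ℕ → A × Z) × (Fin C → X) × (Fin C → ℝ≥0) × A =>
      fun y => rew t y q.2.2.2) (by fun_prop) (by fun_prop)
      ((hrew t).comp (by fun_prop : Measurable
        fun q : ((ℕ → A × Z) × (Fin C → X) × (Fin C → ℝ≥0) × A) × X => (q.2, q.1.2.2.2)))
  induction k generalizing t with
  | zero => exact hpm t
  | succ k ih =>
    simp only [QMPAux]
    refine (hpm t).add (Measurable.const_mul ?_ _)
    have h := measurable_integral_r (M.particleStep g
      (fun q : (ℕ → A × Z) × (Fin C → X) × (Fin C → ℝ≥0) × A => q.2.1) (fun q => q.2.2.1)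
      (fun q => q.2.2.2) (by fun_prop) (by fun_prop) (by fun_prop))
      (r := fun q y => M.QMPAux g rew π k (t + 1) (Function.update q.1 t (q.2.2.2, y.1)) y.2
          (fun j => q.2.2.1 j * g.dens (y.2 j) y.1)
          (π.action (t + 1) (Function.update q.1 t (q.2.2.2, y.1)))) ?_
    · simpa only [particleStep_apply] using h
    · have hu : Measurable fun q : ((ℕ → A × Z) × (Fin C → X) × (Fin C → ℝ≥0) × A) ×
          (Z × (Fin C → X)) => Function.update q.1.1 t (q.1.2.2.2, q.2.1) :=
        measurable_update_snd (by fun_prop) (by fun_prop) t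
      have hw : Measurable fun q : ((ℕ → A × Z) × (Fin C → X) × (Fin C → ℝ≥0) × A) ×
          (Z × (Fin C → X)) => fun j => q.1.2.2.1 j * g.dens (q.2.2 j) q.2.1 := by
        refine measurable_pi_iff.2 fun j => Measurable.mul (by fun_prop) ?_
        exact g.measurable_dens.comp (by fun_prop : Measurable
          fun q : ((ℕ → A × Z) × (Fin C → X) × (Fin C → ℝ≥0) × A) ×
          (Z × (Fin C → X)) => (q.2.2 j, q.2.1))
      exact (ih (t + 1)).comp (hu.prodMk (Measurable.prodMk (by fun_prop)
        (hw.prodMk ((π.measurable_action _).comp hu))))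

/-! ### Bounds on the action values -/

theorem VmaxAt_horizon (Rmax : ℕ → ℝ) : M.VmaxAt Rmax M.L = Rmax M.L := by
  simp [VmaxAt]

theorem VmaxAt_step (Rmax : ℕ → ℝ) {t : ℕ} (ht : t < M.L) :
    M.VmaxAt Rmax t = Rmax t + M.γ * M.VmaxAt Rmax (t + 1) := by
  unfold VmaxAt
  rw [← Finset.add_sum_Ioc_eq_sum_Icc ht.le, Finset.mul_sum, Nat.sub_self, pow_zero, one_mul]
  congr 1
  refine Finset.sum_congr (by ext; simp) fun i hi => ?_
  have hi' := Finset.mem_Icc.1 hi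
  rw [← mul_assoc, ← pow_succ', show i - (t + 1) + 1 = i - t by omega]

theorem VmaxAt_nonneg {Rmax : ℕ → ℝ} (hR : ∀ t ≤ M.L, 0 ≤ Rmax t) (t : ℕ) :
    0 ≤ M.VmaxAt Rmax t :=
  Finset.sum_nonneg fun i hi =>
    mul_nonneg (pow_nonneg M.γ_pos.le _) (hR i (Finset.mem_Icc.1 hi).2)

theorem VmaxAt_le_Vmax (Rmax : ℕ → ℝ) {t : ℕ} (ht : t ≤ M.L) : M.VmaxAt Rmax t ≤ M.Vmax Rmax :=
  Finset.le_sup' (M.VmaxAt Rmax) (Finset.mem_range.2 (Nat.lt_succ_of_le ht))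

/-- If all weights vanish the quotient is `0`, so the bound needs no positivity of the weights, only
`0 ≤ c`. -/
theorem abs_particleMean_le {X : Type*} {C : ℕ} (x : Fin C → X) (w : Fin C → ℝ≥0) {f : X → ℝ}
    {c : ℝ} (hf : ∀ j, |f (x j)| ≤ c) (hc : 0 ≤ c) : |particleMean x w f| ≤ c := by
  unfold particleMean
  have hw : 0 ≤ ∑ j, (w j : ℝ) := Finset.sum_nonneg fun j _ => (w j).2
  rw [abs_div, abs_of_nonneg hw]
  refine div_le_of_le_mul₀ hw hc ((Finset.abs_sum_le_sum_abs _ _).trans ?_)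
  rw [Finset.mul_sum]
  refine Finset.sum_le_sum fun j _ => ?_
  rw [abs_mul, abs_of_nonneg (NNReal.coe_nonneg (w j)), mul_comm c]
  exact mul_le_mul_of_nonneg_left (hf _) (w j).2

theorem abs_add_discount_le {x y : ℝ} {Rmax : ℕ → ℝ} {t : ℕ} (ht : t < M.L) (hx : |x| ≤ Rmax t)
    (hy : |y| ≤ M.VmaxAt Rmax (t + 1)) : |x + M.γ * y| ≤ M.VmaxAt Rmax t := by
  rw [M.VmaxAt_step Rmax ht]
  refine (abs_add_le _ _).trans (add_le_add hx ?_)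
  rw [abs_mul, abs_of_pos M.γ_pos]
  exact mul_le_mul_of_nonneg_left hy M.γ_pos.le

theorem abs_QPAux_le [SFinite vol] {Rmax : ℕ → ℝ} (hR0 : ∀ t ≤ M.L, 0 ≤ Rmax t)
    (hR : ∀ t ≤ M.L, ∀ x a, |M.r t x a| ≤ Rmax t) (π : Policy A Z) {k t : ℕ} (hkt : t + k = M.L)
    (s : ℕ → A × Z) (a : A) : |M.QPAux g π k t s a| ≤ M.VmaxAt Rmax t := by
  have hb : ∀ t ≤ M.L, ∀ s a, |∫ x, M.r t x a ∂(M.belief g s t)| ≤ Rmax t := fun t ht s a =>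
    abs_integral_le_of_measure_univ_le_one (M.belief_univ_le_one g s t) (fun x => hR t ht x a)
      (hR0 t ht)
  induction k generalizing t s a with
  | zero =>
    have h : t = M.L := by omega
    rw [QPAux, h, VmaxAt_horizon]
    exact hb _ le_rfl _ _
  | succ k ih =>
    rw [QPAux]
    refine M.abs_add_discount_le (by omega) (hb t (by omega) s a)
      (abs_integral_le_of_measure_univ_le_one ?_ (fun z => ih (by omega) _ _)
        (M.VmaxAt_nonneg hR0 _))
    rw [M.obsLaw_univ g]
    exact M.belief_univ_le_one g s t

theorem abs_QMPAux_le [SFinite vol] {C : ℕ} {Rmax : ℕ → ℝ} (hR0 : ∀ t ≤ M.L, 0 ≤ Rmax t)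
    {rew : ℕ → X → A → ℝ} (hR : ∀ t ≤ M.L, ∀ x a, |rew t x a| ≤ Rmax t) (π : Policy A Z)
    {k t : ℕ} (hkt : t + k = M.L) (s : ℕ → A × Z) (x : Fin C → X) (w : Fin C → ℝ≥0) (a : A) :
    |M.QMPAux g rew π k t s x w a| ≤ M.VmaxAt Rmax t := by
  induction k generalizing t s x w a with
  | zero =>
    have h : t = M.L := by omega
    rw [QMPAux, h, VmaxAt_horizon]
    exact abs_particleMean_le x w (fun j => hR _ le_rfl (x j) a) (hR0 _ le_rfl)
  | succ k ih =>
    rw [QMPAux]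
    refine M.abs_add_discount_le (by omega)
      (abs_particleMean_le x w (fun j => hR t (by omega) (x j) a) (hR0 t (by omega)))
      (abs_integral_le_of_measure_univ_le_one ?_ (fun z => ih (by omega) _ _ _ _)
        (M.VmaxAt_nonneg hR0 _))
    rw [Measure.prod_apply MeasurableSet.univ]
    simp only [Set.preimage_univ, measure_univ, lintegral_const, one_mul]
    rw [M.obsLaw_univ g]
    exact particleMeasure_univ_le_one x w

/-! ### Extending trajectories and histories by one step -/

theorem lintegral_pathLaw_succ (a : ℕ → A) (n : ℕ) {f : (ℕ → X) → ℝ≥0∞} (hf : Measurable f) :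
    ∫⁻ p, f p ∂(M.pathLaw a (n + 1)) =
      ∫⁻ p, ∫⁻ y, f (Function.update p (n + 1) y) ∂(M.T (p n, a n)) ∂(M.pathLaw a n) := by
  rw [pathLaw, lintegral_map hf (measurable_update_pair _),
    Measure.lintegral_compProd (f := fun q : (ℕ → X) × X => f (Function.update q.1 (n + 1) q.2))
      (hf.comp (measurable_update_pair _))]
  rfl

theorem pathLaw_congr {a a' : ℕ → A} {n : ℕ} (h : ∀ i < n, a i = a' i) :
    M.pathLaw a n = M.pathLaw a' n := by
  induction n with
  | zero => rfl
  | succ n ih =>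
    rw [pathLaw, pathLaw, ih fun i hi => h i (by omega), h n (by omega)]

/-- The law of `C` independent state trajectories. -/
def particlesLaw (C : ℕ) (a : ℕ → A) (n : ℕ) : Measure (Fin C → ℕ → X) :=
  Measure.pi fun _ => M.pathLaw a n

instance (C : ℕ) (a : ℕ → A) (n : ℕ) : IsProbabilityMeasure (M.particlesLaw C a n) := by
  unfold particlesLaw; infer_instance

theorem lintegral_particlesLaw_succ (C : ℕ) (a : ℕ → A) (n : ℕ) {f : (Fin C → ℕ → X) → ℝ≥0∞}
    (hf : Measurable f) :
    ∫⁻ x, f x ∂(M.particlesLaw C a (n + 1)) =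
      ∫⁻ x, ∫⁻ y, f (fun j => Function.update (x j) (n + 1) (y j))
        ∂(Measure.pi fun j => M.T (x j n, a n)) ∂(M.particlesLaw C a n) := by
  have h1 : M.particlesLaw C a (n + 1) =
      (Measure.pi fun _ : Fin C => (M.pathLaw a n) ⊗ₘ (M.stepKernel n (a n))).map
        (fun x j => Function.update (x j).1 (n + 1) (x j).2) := by
    have : ∀ _ : Fin C, SigmaFinite (((M.pathLaw a n) ⊗ₘ (M.stepKernel n (a n))).map
        (fun q => Function.update q.1 (n + 1) q.2)) := fun _ => by
      change SigmaFinite (M.pathLaw a (n + 1)); infer_instance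
    rw [Measure.pi_map_pi (f := fun _ (q : (ℕ → X) × X) => Function.update q.1 (n + 1) q.2)
      (fun _ => (measurable_update_pair (n + 1)).aemeasurable)]
    rfl
  have hm : Measurable fun (x : Fin C → (ℕ → X) × X) (j : Fin C) =>
      Function.update (x j).1 (n + 1) (x j).2 :=
    measurable_pi_iff.2 fun j => (measurable_update_pair (n + 1)).comp (measurable_pi_apply j)
  have hm2 : Measurable fun (q : (Fin C → ℕ → X) × (Fin C → X)) (j : Fin C) => (q.1 j, q.2 j) := by
    fun_prop
  have hfm : Measurable fun x : Fin C → (ℕ → X) × X =>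
      f fun j => Function.update (x j).1 (n + 1) (x j).2 := hf.comp hm
  have hfm2 : Measurable fun q : (Fin C → ℕ → X) × (Fin C → X) =>
      f fun j => Function.update (q.1 j) (n + 1) (q.2 j) := hfm.comp hm2
  rw [h1, lintegral_map hf hm, pi_compProd_eq_map, lintegral_map hfm hm2,
    Measure.lintegral_compProd hfm2]
  rfl

theorem _root_.PBMDP.ObsDensity.lik_congr_traj {A : Type*} (s : ℕ → A × Z) {t : ℕ} {p p' : ℕ → X}
    (h : ∀ i ≤ t, p i = p' i) : g.lik s t p = g.lik s t p' := by
  refine Finset.prod_congr rfl fun i hi => ?_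
  rw [h (i + 1) (by simpa using hi)]

theorem _root_.PBMDP.ObsDensity.lik_succ {A : Type*} (s : ℕ → A × Z) (t : ℕ) (e : A × Z) (p : ℕ → X) :
    g.lik (Function.update s t e) (t + 1) p = g.lik s t p * g.dens (p (t + 1)) e.2 := by
  unfold ObsDensity.lik
  rw [Finset.prod_range_succ, Function.update_self]
  congr 1
  refine Finset.prod_congr rfl fun i hi => ?_
  rw [Function.update_of_ne (Finset.mem_range.1 hi).ne]

theorem _root_.PBMDP.ObsDensity.lik_succ_update {A : Type*} (s : ℕ → A × Z) (t : ℕ) (e : A × Z) (p : ℕ → X)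
    (y : X) : g.lik (Function.update s t e) (t + 1) (Function.update p (t + 1) y) =
      g.lik s t p * g.dens y e.2 := by
  rw [g.lik_succ, Function.update_self]
  congr 1
  exact g.lik_congr_traj s fun i hi => Function.update_of_ne (by omega) _ _

theorem measurable_lik_right (s : ℕ → A × Z) (t : ℕ) : Measurable (g.lik s t) :=
  (measurable_lik g t).comp measurable_prodMk_left

theorem pathLaw_update {Z : Type*} (s : ℕ → A × Z) (t : ℕ) (e : A × Z) :
    M.pathLaw (fun i => (Function.update s t e i).1) t = M.pathLaw (fun i => (s i).1) t :=
  M.pathLaw_congr fun i hi => by rw [Function.update_of_ne hi.ne]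

/-- Density of the next observation under the belief. -/
def predDens (s : ℕ → A × Z) (t : ℕ) (a : A) (z : Z) : ℝ≥0∞ :=
  ∫⁻ x, M.nextDens g x a z ∂(M.belief g s t)

theorem predDens_eq (s : ℕ → A × Z) (t : ℕ) (a : A) (z : Z) :
    M.predDens g s t a z = (M.evidence g s t)⁻¹ *
      ∫⁻ p, (g.lik s t p : ℝ≥0∞) * M.nextDens g (p t) a z ∂(M.pathLaw (fun i => (s i).1) t) :=
  M.lintegral_belief g s t (M.measurable_nextDens g measurable_id measurable_const measurable_const)

theorem evidence_succ (s : ℕ → A × Z) (t : ℕ) (a : A) (z : Z) :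
    M.evidence g (Function.update s t (a, z)) (t + 1) =
      ∫⁻ p, (g.lik s t p : ℝ≥0∞) * M.nextDens g (p t) a z
        ∂(M.pathLaw (fun i => (s i).1) t) := by
  rw [evidence, lintegral_pathLaw_succ _ _ _ (measurable_lik_right g _ _).coe_nnreal_ennreal,
    pathLaw_update]
  refine lintegral_congr fun p => ?_
  simp only [g.lik_succ_update, ENNReal.coe_mul, Function.update_self]
  rw [lintegral_const_mul]
  · rfl
  · exact (g.measurable_dens.comp measurable_prodMk_right).coe_nnreal_ennreal

/-- The chain rule for observation densities. It also shows that the extended history is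
nondegenerate exactly where the predictive density is neither `0` nor `∞`. -/
theorem evidence_succ_eq_mul (s : ℕ → A × Z) (t : ℕ) (a : A) (z : Z)
    (h0 : M.evidence g s t ≠ 0) (h1 : M.evidence g s t ≠ ∞) :
    M.evidence g (Function.update s t (a, z)) (t + 1) =
      M.evidence g s t * M.predDens g s t a z := by
  rw [evidence_succ, predDens_eq, ← mul_assoc, ENNReal.mul_inv_cancel h0 h1, one_mul]

theorem belief_univ (s : ℕ → A × Z) (t : ℕ) (h0 : M.evidence g s t ≠ 0)
    (h1 : M.evidence g s t ≠ ∞) : M.belief g s t Set.univ = 1 := by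
  have h := M.lintegral_belief g s t (f := fun _ => 1) measurable_const
  simp only [lintegral_const, one_mul, mul_one] at h
  rw [h]
  exact ENNReal.inv_mul_cancel h0 h1

theorem lintegral_predDens [SFinite vol] (s : ℕ → A × Z) (t : ℕ) (a : A)
    (h0 : M.evidence g s t ≠ 0) (h1 : M.evidence g s t ≠ ∞) :
    ∫⁻ z, M.predDens g s t a z ∂vol = 1 := by
  rw [← M.belief_univ g s t h0 h1]
  exact M.lintegral_lintegral_nextDens g _ a

theorem measurable_predDens {S : Type*} [MeasurableSpace S] (t : ℕ) {s : S → ℕ → A × Z}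
    {a : S → A} {z : S → Z} (hs : Measurable s) (ha : Measurable a) (hz : Measurable z) :
    Measurable fun q => M.predDens g (s q) t (a q) (z q) :=
  M.measurable_lintegral_nextDens g ((M.beliefKernel g t).comap s hs) ha hz

theorem predDens_ae_lt_top [SFinite vol] (s : ℕ → A × Z) (t : ℕ) (a : A) :
    ∀ᵐ z ∂vol, M.predDens g s t a z < ∞ := by
  refine ae_lt_top (M.measurable_predDens g t measurable_const measurable_const measurable_id) ?_
  have h := M.lintegral_lintegral_nextDens g (M.belief g s t) a
  exact (h.le.trans (M.belief_univ_le_one g s t)).trans_lt ENNReal.one_lt_top |>.ne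

/-- The likelihood bound at time `t + 1`, for the history extended by `(a, z)`, averaged over the
last state. By the chain rule the right side becomes a multiple of the predictive density, which
serves both as the range in the L¹ Hoeffding bound and in the change of measure. -/
theorem lik_mul_nextDens_le {d : ℝ} (hd : M.LikelihoodBound g d) {t : ℕ} (ht : t < M.L)
    (s : ℕ → A × Z) (a : A) (z : Z) (h0 : M.evidence g s t ≠ 0) (h1 : M.evidence g s t ≠ ∞) :
    ∀ᵐ p ∂(M.pathLaw (fun i => (s i).1) t), (g.lik s t p : ℝ≥0∞) * M.nextDens g (p t) a z ≤
      ENNReal.ofReal d * (M.evidence g s t * M.predDens g s t a z) := by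
  have h := hd (t + 1) ht (Function.update s t (a, z))
  rw [evidence_succ_eq_mul M g s t a z h0 h1] at h
  set D := ENNReal.ofReal d * (M.evidence g s t * M.predDens g s t a z)
  rw [pathLaw, ae_map_iff (measurable_update_pair _).aemeasurable
    (measurableSet_le (measurable_lik_right g _ _).coe_nnreal_ennreal measurable_const),
    pathLaw_update] at h
  filter_upwards [Measure.ae_ae_of_ae_compProd h] with p hp
  simp only [g.lik_succ_update, ENNReal.coe_mul, Function.update_self] at hp
  have hm : Measurable fun y => (g.dens y z : ℝ≥0∞) :=
    (g.measurable_dens.comp measurable_prodMk_right).coe_nnreal_ennreal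
  rw [nextDens, ← lintegral_const_mul _ hm]
  refine (lintegral_mono_ae (μ := M.T (p t, a)) (g := fun _ => D) hp).trans ?_
  simp

/-- The states at time `t` and the weights of the particle trajectories `x`. -/
def particlesAt {C : ℕ} (s : ℕ → A × Z) (t : ℕ) (x : Fin C → ℕ → X) :
    (Fin C → X) × (Fin C → ℝ≥0) :=
  (fun j => x j t, fun j => g.lik s t (x j))

theorem measurable_particlesAt {C : ℕ} (s : ℕ → A × Z) (t : ℕ) :
    Measurable (particlesAt (C := C) g s t) := by
  refine Measurable.prodMk (by fun_prop) (measurable_pi_iff.2 fun j => ?_)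
  exact (measurable_lik_right g s t).comp (measurable_pi_apply j)

/-- The states and weights at time `t` do not read the later coordinates, and each later step
integrates to one. -/
theorem lintegral_particlesAt_mono {C : ℕ} (s : ℕ → A × Z) {t n : ℕ} (htn : t ≤ n)
    {f : (Fin C → X) × (Fin C → ℝ≥0) → ℝ≥0∞} (hf : Measurable f) (a : ℕ → A) :
    ∫⁻ x, f (particlesAt g s t x) ∂(M.particlesLaw C a n) =
      ∫⁻ x, f (particlesAt g s t x) ∂(M.particlesLaw C a t) := by
  induction n, htn using Nat.le_induction with
  | base => rfl
  | succ n hn ih =>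
    rw [lintegral_particlesLaw_succ (f := fun x => f (particlesAt g s t x)) _ _ _ _
      (hf.comp (measurable_particlesAt g s t)), ← ih]
    refine lintegral_congr fun x => ?_
    have h : ∀ y : Fin C → X, particlesAt g s t (fun j => Function.update (x j) (n + 1) (y j)) =
        particlesAt g s t x := by
      intro y
      unfold particlesAt
      congr 1
      · funext j
        exact Function.update_of_ne (by omega) _ _
      · funext j
        exact g.lik_congr_traj s fun i hi => Function.update_of_ne (by omega) _ _
    simp [h]

/-- Without resampling, propagating the particles and multiplying the weights by the likelihoods of
a fixed `z` is the same as drawing trajectories one step longer for the extended history. This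
reduces future particle beliefs to the situation of a fixed history. -/
theorem lintegral_particlesAt_succ {C : ℕ} (s : ℕ → A × Z) (t : ℕ) (a : A) (z : Z)
    {f : (Fin C → X) × (Fin C → ℝ≥0) → ℝ≥0∞} (hf : Measurable f) :
    ∫⁻ x, f (particlesAt g (Function.update s t (a, z)) (t + 1) x)
        ∂(M.particlesLaw C (fun i => (Function.update s t (a, z) i).1) (t + 1)) =
      ∫⁻ x, ∫⁻ y, f (y, fun j => (particlesAt g s t x).2 j * g.dens (y j) z)
        ∂(Measure.pi fun j => M.T ((particlesAt g s t x).1 j, a))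
        ∂(M.particlesLaw C (fun i => (s i).1) t) := by
  rw [lintegral_particlesLaw_succ
    (f := fun x => f (particlesAt g (Function.update s t (a, z)) (t + 1) x)) _ _ _ _
    (hf.comp (measurable_particlesAt g _ _))]
  have h : M.particlesLaw C (fun i => (Function.update s t (a, z) i).1) t =
      M.particlesLaw C (fun i => (s i).1) t := by
    unfold particlesLaw; rw [pathLaw_update]
  rw [h]
  refine lintegral_congr fun x => ?_
  simp only [particlesAt, g.lik_succ_update, Function.update_self]

end POMDP

/-! ### Concentration of a particle belief at a fixed history -/

theorem measure_abs_mean_sub_ge_le {E : Type*} [MeasurableSpace E] (μ : Measure E)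
    [IsProbabilityMeasure μ] {C : ℕ} (hC : 0 < C) {f : E → ℝ} (hf : Measurable f) {a l : ℝ}
    (hl : 0 < l) (hb : ∀ᵐ x ∂μ, f x ∈ Set.Icc a (a + l)) {ε : ℝ} (hε : 0 ≤ ε) :
    (Measure.pi fun _ : Fin C => μ) {x | ε ≤ |(∑ j, f (x j)) / C - ∫ x, f x ∂μ|} ≤
      ENNReal.ofReal (2 * Real.exp (-(2 * C * ε ^ 2 / l ^ 2))) := by
  have h := measure_lintegral_abs_mean_sub_ge_le μ (Measure.dirac ()) hC (h := fun x _ => f x)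
    (hf.comp measurable_fst) (p := fun _ => 1) (A := fun _ => a) (m := fun _ => ∫ x, f x ∂μ)
    measurable_const measurable_const (fun _ => zero_le_one) (by simp) hl
    (ae_of_all _ fun _ => by simpa using hb) (ae_of_all _ fun _ => rfl) hε
  refine (measure_mono fun x hx => ?_).trans h
  simpa using ENNReal.ofReal_le_ofReal hx

namespace POMDP

variable {X A Z : Type*} [MeasurableSpace X] [MeasurableSpace A] [MeasurableSpace Z]
variable (M : POMDP X A) {vol : Measure Z} (g : ObsDensity X vol)

/-- A particle weight relative to the density of the observations of the history. -/
def normWeight (s : ℕ → A × Z) (t : ℕ) (v : ℝ≥0) : ℝ := v / (M.evidence g s t).toReal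

/-- The particle belief `(x, w)` approximates the belief of the history `s` with respect to its
total mass (up to `ε`), the mean of the reward (up to `η`) and the law of the next observation (up
to `ε` in total variation). -/
def Regular {C : ℕ} (ε η : ℝ) (t : ℕ) (s : ℕ → A × Z) (x : Fin C → X) (w : Fin C → ℝ≥0)
    (a : A) : Prop :=
  (M.evidence g s t ≠ 0 ∧ M.evidence g s t ≠ ∞) ∧
  |(∑ j, M.normWeight g s t (w j)) / C - 1| < ε ∧
  |(∑ j, M.normWeight g s t (w j) * M.r t (x j) a) / C - ∫ x, M.r t x a ∂(M.belief g s t)| < η ∧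
  (t < M.L → ∫⁻ z, ENNReal.ofReal |(∑ j, M.normWeight g s t (w j) *
    (M.nextDens g (x j) a z).toReal) / C - (M.predDens g s t a z).toReal| ∂vol <
      ENNReal.ofReal ε)

theorem measurable_normWeight {S : Type*} [MeasurableSpace S] (t : ℕ) {s : S → ℕ → A × Z}
    {v : S → ℝ≥0} (hs : Measurable s) (hv : Measurable v) :
    Measurable fun q => M.normWeight g (s q) t (v q) := by
  unfold normWeight
  have h := (M.measurable_evidence g t).comp hs
  exact hv.coe_nnreal_real.div h.ennreal_toReal

theorem measurable_regular_total {C : ℕ} (t : ℕ) :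
    Measurable fun q : (ℕ → A × Z) × (Fin C → X) × (Fin C → ℝ≥0) × A =>
      |(∑ j, M.normWeight g q.1 t (q.2.2.1 j)) / C - 1| := by
  refine (((Finset.measurable_sum _ fun j _ => ?_).div_const _).sub_const _).abs
  exact M.measurable_normWeight g t (by fun_prop) (by fun_prop)

theorem measurable_regular_reward {C : ℕ} (t : ℕ) :
    Measurable fun q : (ℕ → A × Z) × (Fin C → X) × (Fin C → ℝ≥0) × A =>
      |(∑ j, M.normWeight g q.1 t (q.2.2.1 j) * M.r t (q.2.1 j) q.2.2.2) / C -
        ∫ x, M.r t x q.2.2.2 ∂(M.belief g q.1 t)| := by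
  refine (((Finset.measurable_sum _ fun j _ => ?_).div_const _).sub ?_).abs
  · refine Measurable.mul (M.measurable_normWeight g t (by fun_prop) (by fun_prop)) ?_
    exact (M.measurable_r t).comp (by fun_prop : Measurable
      fun q : (ℕ → A × Z) × (Fin C → X) × (Fin C → ℝ≥0) × A => (q.2.1 j, q.2.2.2))
  · exact M.measurable_integral_belief g t (by fun_prop) (by fun_prop)

theorem measurable_regular_obs [SFinite vol] {C : ℕ} (t : ℕ) :
    Measurable fun q : (ℕ → A × Z) × (Fin C → X) × (Fin C → ℝ≥0) × A =>
      ∫⁻ z, ENNReal.ofReal |(∑ j, M.normWeight g q.1 t (q.2.2.1 j) *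
        (M.nextDens g (q.2.1 j) q.2.2.2 z).toReal) / C -
        (M.predDens g q.1 t q.2.2.2 z).toReal| ∂vol := by
  refine Measurable.lintegral_prod_right
    (f := fun (q : (ℕ → A × Z) × (Fin C → X) × (Fin C → ℝ≥0) × A) z =>
      ENNReal.ofReal |(∑ j, M.normWeight g q.1 t (q.2.2.1 j) *
        (M.nextDens g (q.2.1 j) q.2.2.2 z).toReal) / C -
        (M.predDens g q.1 t q.2.2.2 z).toReal|) ?_
  refine ENNReal.measurable_ofReal.comp
    (((Finset.measurable_sum _ fun j _ => Measurable.mul ?_ ?_).div_const _).sub ?_).abs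
  · exact M.measurable_normWeight g t (by fun_prop) (by fun_prop)
  · exact (M.measurable_nextDens g (by fun_prop) (by fun_prop) (by fun_prop)).ennreal_toReal
  · exact (M.measurable_predDens g t (by fun_prop) (by fun_prop) (by fun_prop)).ennreal_toReal

theorem measurableSet_regular [SFinite vol] {C : ℕ} (ε η : ℝ) (t : ℕ) :
    MeasurableSet {q : (ℕ → A × Z) × (Fin C → X) × (Fin C → ℝ≥0) × A |
      M.Regular g ε η t q.1 q.2.1 q.2.2.1 q.2.2.2} := by
  have hev : Measurable fun q : (ℕ → A × Z) × (Fin C → X) × (Fin C → ℝ≥0) × A =>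
    M.evidence g q.1 t := (M.measurable_evidence g t).comp measurable_fst
  unfold Regular
  refine Measurable.setOf (Measurable.and (Measurable.and ?_ ?_)
    (Measurable.and ?_ (Measurable.and ?_ ?_)))
  · exact Measurable.not (measurableSet_setOfPred.1 (hev (measurableSet_singleton 0)))
  · exact Measurable.not (measurableSet_setOfPred.1 (hev (measurableSet_singleton ∞)))
  · exact measurableSet_setOfPred.1
      (measurableSet_lt (M.measurable_regular_total g t) measurable_const)
  · exact measurableSet_setOfPred.1
      (measurableSet_lt (M.measurable_regular_reward g t) measurable_const)
  · exact Measurable.imp measurable_const (measurableSet_setOfPred.1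
      (measurableSet_lt (M.measurable_regular_obs g t) measurable_const))

theorem normWeight_eq_toReal (s : ℕ → A × Z) (t : ℕ) (v : ℝ≥0) :
    M.normWeight g s t v = ((M.evidence g s t)⁻¹ * v).toReal := by
  rw [normWeight, ENNReal.toReal_mul, ENNReal.toReal_inv, ENNReal.coe_toReal, div_eq_inv_mul]

/-- Unbiasedness of importance sampling: the normalized weight is the density that defines the
belief. -/
theorem integral_normWeight_mul (s : ℕ → A × Z) (t : ℕ) {f : X → ℝ} (hf : Measurable f) :
    ∫ p, M.normWeight g s t (g.lik s t p) * f (p t) ∂(M.pathLaw (fun i => (s i).1) t) =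
      ∫ x, f x ∂(M.belief g s t) := by
  have hl := measurable_lik_right g s t
  rw [belief, integral_smul_measure, integral_map (measurable_pi_apply t).aemeasurable hf.aestronglyMeasurable,
    integral_withDensity_eq_integral_toReal_smul hl.coe_nnreal_ennreal
      (ae_of_all _ fun _ => ENNReal.coe_lt_top), ← integral_smul]
  refine integral_congr_ae (ae_of_all _ fun p => ?_)
  simp only [normWeight, ENNReal.toReal_inv, ENNReal.coe_toReal, smul_eq_mul]
  ring

theorem normWeight_mem_Icc {d : ℝ} (hd : M.LikelihoodBound g d) (hd0 : 0 ≤ d) {t : ℕ}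
    (ht : t ≤ M.L) (s : ℕ → A × Z) (h0 : M.evidence g s t ≠ 0) (h1 : M.evidence g s t ≠ ∞) :
    ∀ᵐ p ∂(M.pathLaw (fun i => (s i).1) t),
      M.normWeight g s t (g.lik s t p) ∈ Set.Icc 0 d := by
  filter_upwards [hd t ht s] with p hp
  refine ⟨div_nonneg (NNReal.coe_nonneg _) ENNReal.toReal_nonneg, ?_⟩
  rw [normWeight, div_le_iff₀ (ENNReal.toReal_pos h0 h1)]
  have := ENNReal.toReal_mono (ENNReal.mul_ne_top ENNReal.ofReal_ne_top h1) hp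
  rwa [ENNReal.toReal_mul, ENNReal.toReal_ofReal hd0, ENNReal.coe_toReal] at this

theorem integral_normWeight (s : ℕ → A × Z) (t : ℕ) (h0 : M.evidence g s t ≠ 0)
    (h1 : M.evidence g s t ≠ ∞) :
    ∫ p, M.normWeight g s t (g.lik s t p) ∂(M.pathLaw (fun i => (s i).1) t) = 1 := by
  have h := M.integral_normWeight_mul g s t (f := fun _ => 1) measurable_const
  simp only [mul_one, integral_const, smul_eq_mul, Measure.real, M.belief_univ g s t h0 h1] at h
  simpa using h

theorem measurable_normWeight_lik (s : ℕ → A × Z) (t : ℕ) :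
    Measurable fun p => M.normWeight g s t (g.lik s t p) :=
  M.measurable_normWeight g t measurable_const (measurable_lik_right g s t)

/-- Three Hoeffding bounds, for the normalized weights, for these times the reward, and for these
times the next observation density in L¹. Each fails with probability at most `2 exp(-2Cε²/d²)`. -/
theorem particlesLaw_not_regular_le [SFinite vol] {C : ℕ} (hC : 0 < C) {d : ℝ}
    (hd : M.LikelihoodBound g d) (hd0 : 0 < d) {V : ℝ} (hV : 0 < V) {t : ℕ} (ht : t ≤ M.L)
    (hr : ∀ x a, |M.r t x a| ≤ V) (s : ℕ → A × Z) (h0 : M.evidence g s t ≠ 0)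
    (h1 : M.evidence g s t ≠ ∞) (a : A) {ε : ℝ} (hε : 0 ≤ ε) :
    M.particlesLaw C (fun i => (s i).1) t {x | ¬ M.Regular g ε (V * (2 * ε)) t s
        (particlesAt g s t x).1 (particlesAt g s t x).2 a} ≤
      ENNReal.ofReal (6 * Real.exp (-(2 * C * ε ^ 2 / d ^ 2))) := by
  set μ := M.pathLaw (fun i => (s i).1) t with hμ
  set u : (ℕ → X) → ℝ := fun p => M.normWeight g s t (g.lik s t p) with hu
  have hum : Measurable u := M.measurable_normWeight_lik g s t
  have hub := M.normWeight_mem_Icc g hd hd0.le ht s h0 h1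
  have hrm : Measurable fun p : ℕ → X => M.r t (p t) a := (M.measurable_r t).comp
    (by fun_prop : Measurable fun p : ℕ → X => (p t, a))
  have b1 := measure_abs_mean_sub_ge_le μ hC hum (a := 0) hd0 (by simpa using hub) hε
  rw [M.integral_normWeight g s t h0 h1] at b1
  -- The reward takes both signs, so the range is `2dV`; the tolerance `2εV` makes the exponent the
  -- same as for the weights.
  have b2 := measure_abs_mean_sub_ge_le μ hC (f := fun p => u p * M.r t (p t) a) (hum.mul hrm)
    (a := -(d * V)) (l := 2 * (d * V)) (by positivity) (by
      filter_upwards [hub] with p hp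
      have h2 : |u p * M.r t (p t) a| ≤ d * V := by
        rw [abs_mul, abs_of_nonneg hp.1]
        exact mul_le_mul hp.2 (hr _ _) (abs_nonneg _) hd0.le
      have h3 := abs_le.1 h2
      exact ⟨h3.1, by linarith [h3.2]⟩) (ε := V * (2 * ε)) (by positivity)
  rw [M.integral_normWeight_mul g s t (f := fun x => M.r t x a)
    ((M.measurable_r t).comp measurable_prodMk_right)] at b2
  have e2 : 2 * (C : ℝ) * (V * (2 * ε)) ^ 2 / (2 * (d * V)) ^ 2 = 2 * C * ε ^ 2 / d ^ 2 := by
    field_simp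
  rw [e2] at b2
  have b3 : t < M.L → (Measure.pi fun _ : Fin C => μ) {x | ENNReal.ofReal ε ≤
      ∫⁻ z, ENNReal.ofReal |(∑ j, u (x j) * (M.nextDens g (x j t) a z).toReal) / C -
        (M.predDens g s t a z).toReal| ∂vol} ≤
      ENNReal.ofReal (2 * Real.exp (-(2 * C * ε ^ 2 / d ^ 2))) := by
    intro htL
    have hpm : Measurable fun z => M.predDens g s t a z :=
      M.measurable_predDens g t measurable_const measurable_const measurable_id
    have hfin := M.predDens_ae_lt_top g s t a
    refine measure_lintegral_abs_mean_sub_ge_le μ vol hC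
      (h := fun p z => u p * (M.nextDens g (p t) a z).toReal) ?_ (A := fun _ => 0)
      hpm.ennreal_toReal hpm.ennreal_toReal (fun _ => ENNReal.toReal_nonneg) ?_ hd0 ?_ ?_ hε
    · exact (hum.comp measurable_fst).mul (M.measurable_nextDens g (by fun_prop)
        measurable_const measurable_snd).ennreal_toReal
    · rw [← M.lintegral_predDens g s t a h0 h1]
      refine lintegral_congr_ae ?_
      filter_upwards [hfin] with z hz
      exact ENNReal.ofReal_toReal hz.ne
    · filter_upwards [hfin] with z hz
      filter_upwards [M.lik_mul_nextDens_le g hd htL s a z h0 h1] with p hp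
      refine ⟨mul_nonneg (div_nonneg (NNReal.coe_nonneg _) ENNReal.toReal_nonneg)
        ENNReal.toReal_nonneg, ?_⟩
      have h2 := ENNReal.toReal_mono (ENNReal.mul_ne_top ENNReal.ofReal_ne_top
        (ENNReal.mul_ne_top h1 hz.ne)) hp
      simp only [ENNReal.toReal_mul, ENNReal.toReal_ofReal hd0.le, ENNReal.coe_toReal] at h2
      have h3 := ENNReal.toReal_pos h0 h1
      rw [zero_add, hu]
      simp only [normWeight]
      rw [div_mul_eq_mul_div, div_le_iff₀ h3]
      linarith
    · filter_upwards [hfin] with z hz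
      have h2 : ∀ p, u p * (M.nextDens g (p t) a z).toReal =
          ((M.evidence g s t)⁻¹ * (g.lik s t p * M.nextDens g (p t) a z)).toReal := by
        intro p
        rw [← mul_assoc, ENNReal.toReal_mul, ← normWeight_eq_toReal]
      have h3 : Measurable fun p : ℕ → X => (g.lik s t p : ℝ≥0∞) * M.nextDens g (p t) a z :=
        (measurable_lik_right g s t).coe_nnreal_ennreal.mul
          (M.measurable_nextDens g (by fun_prop) measurable_const measurable_const)
      simp only [h2]
      rw [integral_toReal (h3.const_mul _).aemeasurable, lintegral_const_mul _ h3, ← predDens_eq]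
      filter_upwards [M.lik_mul_nextDens_le g hd htL s a z h0 h1] with p hp
      exact ENNReal.mul_lt_top (ENNReal.inv_lt_top.2 (pos_iff_ne_zero.2 h0)) (hp.trans_lt
        (ENNReal.mul_lt_top ENNReal.ofReal_lt_top (ENNReal.mul_lt_top h1.lt_top hz)))
  have hsub : {x : Fin C → ℕ → X | ¬ M.Regular g ε (V * (2 * ε)) t s
      (particlesAt g s t x).1 (particlesAt g s t x).2 a} ⊆
      {x | ε ≤ |(∑ j, u (x j)) / C - 1|} ∪
      ({x | V * (2 * ε) ≤ |(∑ j, u (x j) * M.r t (x j t) a) / C -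
        ∫ x, M.r t x a ∂(M.belief g s t)|} ∪
      {x | t < M.L ∧ ENNReal.ofReal ε ≤
        ∫⁻ z, ENNReal.ofReal |(∑ j, u (x j) * (M.nextDens g (x j t) a z).toReal) / C -
        (M.predDens g s t a z).toReal| ∂vol}) := by
    intro x hx
    by_contra hcon
    simp only [Set.mem_union, Set.mem_ofPred_eq, not_or, not_and, not_le] at hcon
    exact hx ⟨⟨h0, h1⟩, hcon.1, hcon.2.1, hcon.2.2⟩
  have b3' : (Measure.pi fun _ : Fin C => μ) {x | t < M.L ∧ ENNReal.ofReal ε ≤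
      ∫⁻ z, ENNReal.ofReal |(∑ j, u (x j) * (M.nextDens g (x j t) a z).toReal) / C -
        (M.predDens g s t a z).toReal| ∂vol} ≤
      ENNReal.ofReal (2 * Real.exp (-(2 * C * ε ^ 2 / d ^ 2))) := by
    by_cases htL : t < M.L
    · simpa [htL] using b3 htL
    · simp [htL]
  refine (measure_mono hsub).trans ((measure_union_le _ _).trans
    ((add_le_add b1 ((measure_union_le _ _).trans (add_le_add b2 b3'))).trans (le_of_eq ?_)))
  rw [← ENNReal.ofReal_add (by positivity) (by positivity),
    ← ENNReal.ofReal_add (by positivity) (by positivity)]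
  congr 1
  ring

/-! ### What regularity gives for one step -/

theorem abs_particleMean_sub_le {X : Type*} {C : ℕ} (x : Fin C → X) (w : Fin C → ℝ≥0)
    {f h : X → ℝ} {c : ℝ} (hf : ∀ j, |f (x j) - h (x j)| ≤ c) (hc : 0 ≤ c) :
    |particleMean x w f - particleMean x w h| ≤ c := by
  have : particleMean x w f - particleMean x w h = particleMean x w fun y => f y - h y := by
    simp only [particleMean, mul_sub, Finset.sum_sub_distrib, sub_div]
  rw [this]
  exact abs_particleMean_le x w (f := fun y => f y - h y) hf hc

theorem sum_normWeight_mul {C : ℕ} (s : ℕ → A × Z) (t : ℕ) (w : Fin C → ℝ≥0) (f : Fin C → ℝ) :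
    ∑ j, M.normWeight g s t (w j) * f j =
      (∑ j, (w j : ℝ) * f j) / (M.evidence g s t).toReal := by
  simp only [normWeight, Finset.sum_div]
  exact Finset.sum_congr rfl fun j _ => by ring

/-- The evidence and the factor `C` cancel in a self-normalized mean, so it is a quotient of two
averages that concentrate. -/
theorem div_eq_normWeight_div {C : ℕ} (hC : 0 < C) {s : ℕ → A × Z} {t : ℕ}
    (h0 : M.evidence g s t ≠ 0) (h1 : M.evidence g s t ≠ ∞) (w : Fin C → ℝ≥0) (f : Fin C → ℝ) :
    (∑ j, (w j : ℝ) * f j) / ∑ j, (w j : ℝ) =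
      ((∑ j, M.normWeight g s t (w j) * f j) / C) / ((∑ j, M.normWeight g s t (w j)) / C) := by
  have hev := ENNReal.toReal_pos h0 h1
  have hC' : (C : ℝ) ≠ 0 := by exact_mod_cast hC.ne'
  have h2 := M.sum_normWeight_mul g s t w (fun _ => 1)
  simp only [mul_one] at h2
  rw [h2, sum_normWeight_mul, div_div_div_cancel_right₀ hC', div_div_div_cancel_right₀ hev.ne']

/-- With `N` the mean normalized weight, `S` the weighted mean reward and `m` its limit, `mN - S =
m(N - 1) - (S - m)` is at most `εV + 2εV`. Division by `N > 5/8` gives `(8/5) · 3 · (3/16) λ =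
(9/10) λ`. The missing `λ/10` is kept for the contribution of later failures. -/
theorem Regular.abs_reward_sub_le {C : ℕ} (hC : 0 < C) {ε V lam : ℝ} (hε : ε ≤ 3 / 8)
    (hεV : ε * V ≤ 3 / 16 * lam) {t : ℕ} (hr : ∀ x a, |M.r t x a| ≤ V)
    {s : ℕ → A × Z} {x : Fin C → X} {w : Fin C → ℝ≥0} {a : A} (hV : 0 ≤ V)
    (h : M.Regular g ε (V * (2 * ε)) t s x w a) :
    |∫ y, M.r t y a ∂(M.belief g s t) - particleMean x w (fun y => M.r t y a)| ≤
      9 / 10 * lam := by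
  obtain ⟨⟨h0, h1⟩, hN, hS, -⟩ := h
  rw [particleMean, M.div_eq_normWeight_div g hC h0 h1]
  set N := (∑ j, M.normWeight g s t (w j)) / C
  set S := (∑ j, M.normWeight g s t (w j) * M.r t (x j) a) / C
  set m := ∫ y, M.r t y a ∂(M.belief g s t) with hm
  have hmV : |m| ≤ V :=
    abs_integral_le_of_measure_univ_le_one (M.belief_univ_le_one g s t) (fun y => hr y a) hV
  have hN' := abs_lt.1 hN
  have hN0 : 5 / 8 < N := by linarith
  have h2 : |m * N - S| ≤ 3 * (ε * V) := by
    have : m * N - S = m * (N - 1) - (S - m) := by ring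
    rw [this]
    refine (abs_sub _ _).trans ?_
    rw [abs_mul]
    have := mul_le_mul hmV hN.le (abs_nonneg _) hV
    linarith
  have h3 : m - S / N = (m * N - S) / N := by field_simp
  rw [h3, abs_div, abs_of_pos (show 0 < N by linarith), div_le_iff₀ (by linarith)]
  nlinarith [abs_nonneg (m * N - S)]

theorem lintegral_nextDens_particleMeasure {C : ℕ} (x : Fin C → X) (w : Fin C → ℝ≥0) (a : A)
    (z : Z) : ∫⁻ y, M.nextDens g y a z ∂(particleMeasure x w) =
      (∑ j, (w j : ℝ≥0∞) * M.nextDens g (x j) a z) / ∑ i, (w i : ℝ≥0∞) := by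
  rw [particleMeasure, lintegral_finsetSum_measure]
  simp only [lintegral_smul_measure, smul_eq_mul, div_eq_mul_inv, Finset.sum_mul]
  refine Finset.sum_congr rfl fun j _ => ?_
  rw [lintegral_dirac' (f := fun y => M.nextDens g y a z) _
    (M.measurable_nextDens g measurable_id measurable_const measurable_const)]
  ring

theorem nextDens_ae_lt_top [SFinite vol] (x : X) (a : A) :
    ∀ᵐ z ∂vol, M.nextDens g x a z < ∞ :=
  ae_lt_top (M.measurable_nextDens g measurable_const measurable_const measurable_id)
    (by rw [M.lintegral_nextDens_vol g]; exact ENNReal.one_ne_top)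

theorem integral_obsLaw [SFinite vol] (b : Measure X) [IsFiniteMeasure b] (a : A) (f : Z → ℝ) :
    ∫ z, f z ∂(M.obsLaw g b a) = ∫ z, (∫⁻ x, M.nextDens g x a z ∂b).toReal * f z ∂vol := by
  have hm := M.measurable_lintegral_nextDens_right g b a
  rw [obsLaw_eq, integral_withDensity_eq_integral_toReal_smul hm]
  · rfl
  · refine ae_lt_top hm ?_
    rw [M.lintegral_lintegral_nextDens g]
    exact measure_ne_top _ _

theorem integrable_obsDens [SFinite vol] (b : Measure X) [IsFiniteMeasure b] (a : A) :
    Integrable (fun z => (∫⁻ x, M.nextDens g x a z ∂b).toReal) vol := by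
  refine integrable_toReal_of_lintegral_ne_top
    (M.measurable_lintegral_nextDens_right g b a).aemeasurable ?_
  rw [M.lintegral_lintegral_nextDens g]
  exact measure_ne_top _ _

/-- For the observation densities `p` of the belief and `q` of the particles, `N(p - q) = (N - 1)p -
(Nq - p)`. Both terms have L¹ norm at most `ε`, and `N > 5/8`, so `p` and `q` differ by at most
`16ε/5` in L¹. -/
theorem Regular.abs_integral_obsLaw_sub_le [SFinite vol] {C : ℕ} (hC : 0 < C) {ε η : ℝ}
    (hε0 : 0 ≤ ε) (hε : ε ≤ 3 / 8) {t : ℕ} (ht : t < M.L) {s : ℕ → A × Z} {x : Fin C → X}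
    {w : Fin C → ℝ≥0} {a : A} (h : M.Regular g ε η t s x w a) {f : Z → ℝ} (hf : Measurable f)
    {V : ℝ} (hV : 0 ≤ V) (hfV : ∀ z, |f z| ≤ V) :
    |∫ z, f z ∂(M.obsLaw g (M.belief g s t) a) -
      ∫ z, f z ∂(M.obsLaw g (particleMeasure x w) a)| ≤ V * (16 / 5 * ε) := by
  obtain ⟨⟨h0, h1⟩, hN, -, hT⟩ := h
  replace hT := hT ht
  set N := (∑ j, M.normWeight g s t (w j)) / C with hNdef
  have hN0 : 5 / 8 < N := by linarith [(abs_lt.1 hN).1]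
  have hNp : 0 < N := by linarith
  rw [integral_obsLaw, integral_obsLaw]
  set p : Z → ℝ := fun z => (∫⁻ x, M.nextDens g x a z ∂(M.belief g s t)).toReal with hp
  set q : Z → ℝ := fun z => (∫⁻ y, M.nextDens g y a z ∂(particleMeasure x w)).toReal with hq
  have hpi : Integrable p vol := M.integrable_obsDens g _ a
  have hqi : Integrable q vol := M.integrable_obsDens g _ a
  have hpf : Integrable (fun z => p z * f z) vol :=
    hpi.mul_bdd hf.aestronglyMeasurable (ae_of_all _ hfV)
  have hqf : Integrable (fun z => q z * f z) vol :=
    hqi.mul_bdd hf.aestronglyMeasurable (ae_of_all _ hfV)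
  have hp1 : ∫ z, p z ∂vol = 1 := by
    rw [hp, integral_toReal]
    · have := M.lintegral_predDens g s t a h0 h1
      simp only [predDens] at this
      simp [this]
    · exact (M.measurable_lintegral_nextDens_right g _ a).aemeasurable
    · exact M.predDens_ae_lt_top g s t a
  have hqN : ∀ᵐ z ∂vol, (∑ j, M.normWeight g s t (w j) * (M.nextDens g (x j) a z).toReal) / C =
      N * q z := by
    have hfin : ∀ᵐ z ∂vol, ∀ j, M.nextDens g (x j) a z < ∞ :=
      ae_all_iff.2 fun j => M.nextDens_ae_lt_top g (x j) a
    filter_upwards [hfin] with z hz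
    have e : q z = (∑ j, (w j : ℝ) * (M.nextDens g (x j) a z).toReal) / ∑ j, (w j : ℝ) := by
      simp only [hq]
      rw [lintegral_nextDens_particleMeasure, ENNReal.toReal_div, ENNReal.toReal_sum,
        ENNReal.toReal_sum]
      · simp only [ENNReal.toReal_mul, ENNReal.coe_toReal]
      · exact fun _ _ => ENNReal.coe_ne_top
      · exact fun j _ => ENNReal.mul_ne_top ENNReal.coe_ne_top (hz j).ne
    rw [e, M.div_eq_normWeight_div g hC h0 h1, mul_div_cancel₀ _ hNp.ne']
  have hTi : Integrable (fun z => N * q z - p z) vol := (hqi.const_mul N).sub hpi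
  have hT' : ∫ z, |N * q z - p z| ∂vol ≤ ε := by
    rw [integral_eq_lintegral_of_nonneg_ae (ae_of_all _ fun z => abs_nonneg _)
      hTi.abs.aestronglyMeasurable]
    refine ENNReal.toReal_le_of_le_ofReal hε0 (le_trans (le_of_eq ?_) hT.le)
    refine lintegral_congr_ae ?_
    filter_upwards [hqN] with z hz
    rw [hz]
    rfl
  have hpq : ∀ z, |p z - q z| ≤ 8 / 5 * (|N * q z - p z| + ε * p z) := by
    intro z
    have hpz : 0 ≤ p z := ENNReal.toReal_nonneg
    have e : N * (p z - q z) = (N - 1) * p z - (N * q z - p z) := by ring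
    have h2 : N * |p z - q z| ≤ |N * q z - p z| + ε * p z := by
      rw [← abs_of_pos hNp, ← abs_mul, e, abs_of_pos hNp]
      refine (abs_sub _ _).trans ?_
      rw [abs_mul, abs_of_nonneg hpz]
      have := mul_le_mul_of_nonneg_right hN.le hpz
      linarith
    nlinarith [abs_nonneg (p z - q z)]
  have hL1 : ∫ z, |p z - q z| ∂vol ≤ 16 / 5 * ε := by
    calc ∫ z, |p z - q z| ∂vol ≤ ∫ z, 8 / 5 * (|N * q z - p z| + ε * p z) ∂vol :=
          integral_mono (hpi.sub hqi).abs ((hTi.abs.add (hpi.const_mul ε)).const_mul _) hpq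
      _ = 8 / 5 * (∫ z, |N * q z - p z| ∂vol + ε * 1) := by
          rw [integral_const_mul, integral_add hTi.abs (hpi.const_mul ε), integral_const_mul, hp1]
      _ ≤ 16 / 5 * ε := by linarith
  rw [← integral_sub hpf hqf]
  calc |∫ z, (p z * f z - q z * f z) ∂vol| ≤ ∫ z, |p z * f z - q z * f z| ∂vol :=
        abs_integral_le_integral_abs
    _ ≤ ∫ z, V * |p z - q z| ∂vol := by
        refine integral_mono (hpf.sub hqf).abs ((hpi.sub hqi).abs.const_mul V) fun z => ?_
        simp only
        rw [← sub_mul, abs_mul, mul_comm]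
        exact mul_le_mul_of_nonneg_right (hfV z) (abs_nonneg _)
    _ = V * ∫ z, |p z - q z| ∂vol := integral_const_mul _ _
    _ ≤ V * (16 / 5 * ε) := mul_le_mul_of_nonneg_left hL1 hV

/-- The change of measure from the particle observation law to the true one. Each weighted density
in the numerator is controlled by the likelihood bound, and regularity keeps the total weight above
half of its expected value `C` times the evidence, whence the factor 2. -/
theorem Regular.particleDens_le {C : ℕ} (hC : 0 < C) {ε η : ℝ} (hε : ε ≤ 3 / 8) {t : ℕ}
    {s : ℕ → A × Z} {x : Fin C → X} {w : Fin C → ℝ≥0} {a : A}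
    (h : M.Regular g ε η t s x w a) {z : Z} {D : ℝ≥0∞}
    (hD : ∀ j, (w j : ℝ≥0∞) * M.nextDens g (x j) a z ≤
      D * (M.evidence g s t * M.predDens g s t a z)) :
    ∫⁻ y, M.nextDens g y a z ∂(particleMeasure x w) ≤ 2 * D * M.predDens g s t a z := by
  obtain ⟨⟨h0, h1⟩, hN, -, -⟩ := h
  rw [lintegral_nextDens_particleMeasure]
  have hev := ENNReal.toReal_pos h0 h1
  have hC' : (0 : ℝ) < C := by exact_mod_cast hC
  have hw : (C : ℝ≥0∞) * M.evidence g s t ≤ 2 * ∑ j, (w j : ℝ≥0∞) := by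
    have h2 : (C : ℝ) * (M.evidence g s t).toReal ≤ 2 * ∑ j, (w j : ℝ) := by
      have h3 := M.sum_normWeight_mul g s t w (fun _ => 1)
      simp only [mul_one] at h3
      have h4 : 1 / 2 ≤ (∑ j, M.normWeight g s t (w j)) / C := by linarith [(abs_lt.1 hN).1]
      rw [h3, div_div, div_le_div_iff₀ (by norm_num) (by positivity)] at h4
      linarith
    rw [← ENNReal.toReal_le_toReal]
    · simpa [ENNReal.toReal_mul, ENNReal.toReal_sum] using h2
    · exact ENNReal.mul_ne_top (ENNReal.natCast_ne_top _) h1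
    · exact ENNReal.mul_ne_top (by simp) (by simp)
  refine ENNReal.div_le_of_le_mul ?_
  calc ∑ j, (w j : ℝ≥0∞) * M.nextDens g (x j) a z
      ≤ ∑ _j : Fin C, D * (M.evidence g s t * M.predDens g s t a z) :=
        Finset.sum_le_sum fun j _ => hD j
    _ = (C * M.evidence g s t) * (D * M.predDens g s t a z) := by
        simp only [Finset.sum_const, Finset.card_univ, Fintype.card_fin, nsmul_eq_mul]; ring
    _ ≤ (2 * ∑ j, (w j : ℝ≥0∞)) * (D * M.predDens g s t a z) := by gcongr
    _ = 2 * D * M.predDens g s t a z * ∑ j, (w j : ℝ≥0∞) := by ring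

/-! ### Error recursion in terms of later failures -/

/-- The particle belief is regular, and the reward `rew` is `ν`-close to the exact one at all the
particles. -/
def Accurate {C : ℕ} (rew : ℕ → X → A → ℝ) (ε η ν : ℝ) (t : ℕ) (s : ℕ → A × Z) (x : Fin C → X)
    (w : Fin C → ℝ≥0) (a : A) : Prop :=
  M.Regular g ε η t s x w a ∧ ∀ j, |M.r t (x j) a - rew t (x j) a| < ν

open Classical in
/-- For an accurate particle belief, the expected number (over the next `k` steps and all choices
of the action among those of the policies `pol i`) of the first encounters of a particle belief that
is not accurate. -/
def errTail {ι : Type*} [Fintype ι] {C : ℕ} (rew : ℕ → X → A → ℝ) (pol : ι → Policy A Z)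
    (ε η ν : ℝ) :
    ℕ → ℕ → (ℕ → A × Z) → (Fin C → X) → (Fin C → ℝ≥0) → A → ℝ≥0∞
  | 0, _, _, _, _, _ => 0
  | k + 1, t, s, x, w, a => ∫⁻ q : Z × (Fin C → X), ∑ i,
      (if M.Accurate g rew ε η ν (t + 1) (Function.update s t (a, q.1)) q.2
          (fun j => w j * g.dens (q.2 j) q.1)
          ((pol i).action (t + 1) (Function.update s t (a, q.1)))
        then errTail rew pol ε η ν k (t + 1) (Function.update s t (a, q.1)) q.2
          (fun j => w j * g.dens (q.2 j) q.1)
          ((pol i).action (t + 1) (Function.update s t (a, q.1)))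
        else 1)
      ∂((M.obsLaw g (particleMeasure x w) a).prod (Measure.pi fun j => M.T (x j, a)))

open Classical in
/-- `errTail` for an accurate particle belief, and `1` otherwise. -/
def errBound {ι : Type*} [Fintype ι] {C : ℕ} (rew : ℕ → X → A → ℝ) (pol : ι → Policy A Z)
    (ε η ν : ℝ) (k t : ℕ) (s : ℕ → A × Z) (x : Fin C → X) (w : Fin C → ℝ≥0) (a : A) : ℝ≥0∞ :=
  if M.Accurate g rew ε η ν t s x w a then M.errTail g rew pol ε η ν k t s x w a else 1

theorem errTail_succ {ι : Type*} [Fintype ι] {C : ℕ} (rew : ℕ → X → A → ℝ)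
    (pol : ι → Policy A Z) (ε η ν : ℝ) (k t : ℕ) (s : ℕ → A × Z) (x : Fin C → X)
    (w : Fin C → ℝ≥0) (a : A) :
    M.errTail g rew pol ε η ν (k + 1) t s x w a = ∫⁻ q : Z × (Fin C → X), ∑ i,
      M.errBound g rew pol ε η ν k (t + 1) (Function.update s t (a, q.1)) q.2
          (fun j => w j * g.dens (q.2 j) q.1)
          ((pol i).action (t + 1) (Function.update s t (a, q.1)))
      ∂((M.obsLaw g (particleMeasure x w) a).prod (Measure.pi fun j => M.T (x j, a))) := rfl

section Measurability

variable {Ω : Type*} [MeasurableSpace Ω] {rew : Ω → ℕ → X → A → ℝ}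

theorem measurableSet_accurate [SFinite vol] {C : ℕ}
    (hrew : ∀ t, Measurable fun q : Ω × X × A => rew q.1 t q.2.1 q.2.2) (ε η ν : ℝ) (t : ℕ) :
    MeasurableSet {q : Ω × (ℕ → A × Z) × (Fin C → X) × (Fin C → ℝ≥0) × A |
      M.Accurate g (rew q.1) ε η ν t q.2.1 q.2.2.1 q.2.2.2.1 q.2.2.2.2} := by
  unfold Accurate
  refine Measurable.setOf (Measurable.and ?_ (Measurable.forall fun j => ?_))
  · exact (measurableSet_setOfPred.1 (M.measurableSet_regular g ε η t)).comp measurable_snd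
  · refine measurableSet_setOfPred.1 (measurableSet_lt (Measurable.abs (Measurable.sub ?_ ?_))
      measurable_const)
    · exact (M.measurable_r t).comp (by fun_prop : Measurable
        fun q : Ω × (ℕ → A × Z) × (Fin C → X) × (Fin C → ℝ≥0) × A => (q.2.2.1 j, q.2.2.2.2))
    · exact (hrew t).comp (by fun_prop : Measurable
        fun q : Ω × (ℕ → A × Z) × (Fin C → X) × (Fin C → ℝ≥0) × A => (q.1, q.2.2.1 j, q.2.2.2.2))

theorem measurable_next {S : Type*} [MeasurableSpace S] {ι : Type*} {C : ℕ}
    (pol : ι → Policy A Z) (t : ℕ) (i : ι) {ω : S → Ω} {s : S → ℕ → A × Z} {a : S → A}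
    {z : S → Z} {w : S → Fin C → ℝ≥0} {y : S → Fin C → X} (hω : Measurable ω)
    (hs : Measurable s) (ha : Measurable a) (hz : Measurable z) (hw : Measurable w)
    (hy : Measurable y) :
    Measurable fun q => (ω q, Function.update (s q) t (a q, z q), y q,
      (fun j => w q j * g.dens (y q j) (z q)),
      (pol i).action (t + 1) (Function.update (s q) t (a q, z q))) := by
  have hu : Measurable fun q => Function.update (s q) t (a q, z q) :=
    measurable_update_snd hs (ha.prodMk hz) t
  have hw' : Measurable fun q => fun j => w q j * g.dens (y q j) (z q) := by
    refine measurable_pi_iff.2 fun j => Measurable.mul (by fun_prop) ?_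
    exact g.measurable_dens.comp (by fun_prop : Measurable fun q => (y q j, z q))
  exact hω.prodMk (hu.prodMk (hy.prodMk (hw'.prodMk (((pol i).measurable_action _).comp hu))))

theorem measurable_errTail [SFinite vol] {ι : Type*} [Fintype ι] {C : ℕ}
    (hrew : ∀ t, Measurable fun q : Ω × X × A => rew q.1 t q.2.1 q.2.2) (pol : ι → Policy A Z)
    (ε η ν : ℝ) (k t : ℕ) :
    Measurable fun q : Ω × (ℕ → A × Z) × (Fin C → X) × (Fin C → ℝ≥0) × A =>
      M.errTail g (rew q.1) pol ε η ν k t q.2.1 q.2.2.1 q.2.2.2.1 q.2.2.2.2 := by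
  classical
  induction k generalizing t with
  | zero => exact measurable_const
  | succ k ih =>
    have hb : Measurable fun q : Ω × (ℕ → A × Z) × (Fin C → X) × (Fin C → ℝ≥0) × A =>
        M.errBound g (rew q.1) pol ε η ν k (t + 1) q.2.1 q.2.2.1 q.2.2.2.1 q.2.2.2.2 :=
      Measurable.ite (M.measurableSet_accurate g hrew ε η ν (t + 1)) (ih (t + 1)) measurable_const
    simp only [errTail_succ]
    have h := Measurable.lintegral_kernel_prod_right (κ := M.particleStep g
      (fun q : Ω × (ℕ → A × Z) × (Fin C → X) × (Fin C → ℝ≥0) × A => q.2.2.1) (fun q => q.2.2.2.1)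
      (fun q => q.2.2.2.2) (by fun_prop) (by fun_prop) (by fun_prop))
      (f := fun q y => ∑ i, M.errBound g (rew q.1) pol ε η ν k (t + 1)
        (Function.update q.2.1 t (q.2.2.2.2, y.1)) y.2
        (fun j => q.2.2.2.1 j * g.dens (y.2 j) y.1)
        ((pol i).action (t + 1) (Function.update q.2.1 t (q.2.2.2.2, y.1)))) ?_
    · simpa only [particleStep_apply] using h
    · refine Finset.measurable_sum _ fun i _ => ?_
      exact hb.comp (measurable_next g pol t i
        (S := (Ω × (ℕ → A × Z) × (Fin C → X) × (Fin C → ℝ≥0) × A) × (Z × (Fin C → X)))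
        (ω := fun q => q.1.1) (s := fun q => q.1.2.1) (a := fun q => q.1.2.2.2.2)
        (z := fun q => q.2.1) (w := fun q => q.1.2.2.2.1) (y := fun q => q.2.2) (by fun_prop)
        (by fun_prop) (by fun_prop) (by fun_prop) (by fun_prop) (by fun_prop))

theorem measurable_errBound [SFinite vol] {ι : Type*} [Fintype ι] {C : ℕ}
    (hrew : ∀ t, Measurable fun q : Ω × X × A => rew q.1 t q.2.1 q.2.2) (pol : ι → Policy A Z)
    (ε η ν : ℝ) (k t : ℕ) :
    Measurable fun q : Ω × (ℕ → A × Z) × (Fin C → X) × (Fin C → ℝ≥0) × A =>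
      M.errBound g (rew q.1) pol ε η ν k t q.2.1 q.2.2.1 q.2.2.2.1 q.2.2.2.2 := by
  classical
  exact Measurable.ite (M.measurableSet_accurate g hrew ε η ν t)
    (M.measurable_errTail g hrew pol ε η ν k t) measurable_const

end Measurability

theorem bounds_of_recursion {lam ν : ℝ} (hlam : 0 ≤ lam) (hν : 0 ≤ ν) {α β : ℕ → ℝ}
    (hαL : α M.L = lam) (hα : ∀ t < M.L, α t = (1 + M.γ) * lam + M.γ * α (t + 1))
    (hβL : β M.L = 2 * ν) (hβ : ∀ t < M.L, β t = 2 * ν + M.γ * β (t + 1)) {k t : ℕ}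
    (hkt : t + k = M.L) : lam ≤ α t ∧ 0 ≤ β t := by
  have hγ := M.γ_pos
  induction k generalizing t with
  | zero =>
    have h : t = M.L := by omega
    rw [h, hαL, hβL]
    exact ⟨le_rfl, by linarith⟩
  | succ k ih =>
    obtain ⟨h1, h2⟩ := ih (t := t + 1) (by omega)
    rw [hα t (by omega), hβ t (by omega)]
    have := mul_nonneg hγ.le hlam
    have := mul_nonneg hγ.le (hlam.trans h1)
    have := mul_nonneg hγ.le h2
    constructor <;> nlinarith

/-- Split one step into the reward error, at most `(9/10) λ + ν`, the change of observation law, at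
most `(3/5) λ`, and the average of the next errors under the particle transition. A next error is
handled by induction if the new particle belief is accurate and is at most `2V` otherwise; this is
the recursion of `errTail`. The extra `λ/10` on the left is what Markov's inequality will spend at
the root. -/
theorem Accurate.abs_QPAux_sub_QMPAux_le [SFinite vol] {ι : Type*} [Fintype ι] {C : ℕ}
    (hC : 0 < C) {Rmax : ℕ → ℝ} (hR0 : ∀ t ≤ M.L, 0 ≤ Rmax t)
    (hR : ∀ t ≤ M.L, ∀ x a, |M.r t x a| ≤ Rmax t) {V : ℝ}
    (hRV : ∀ t ≤ M.L, Rmax t ≤ V) (hV : ∀ t ≤ M.L, M.VmaxAt Rmax t ≤ V) (hV0 : 0 < V)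
    {rew : ℕ → X → A → ℝ} (hrew : ∀ t, Measurable fun q : X × A => rew t q.1 q.2)
    (hrewR : ∀ t ≤ M.L, ∀ x a, |rew t x a| ≤ Rmax t)
    {lam ν : ℝ} (hlam : 0 ≤ lam) (hν : 0 ≤ ν) {α β : ℕ → ℝ}
    (hαL : α M.L = lam) (hα : ∀ t < M.L, α t = (1 + M.γ) * lam + M.γ * α (t + 1))
    (hβL : β M.L = 2 * ν) (hβ : ∀ t < M.L, β t = 2 * ν + M.γ * β (t + 1))
    {ε : ℝ} (hε0 : 0 ≤ ε) (hε : ε ≤ 3 / 8) (hεV : ε * V ≤ 3 / 16 * lam)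
    (pol : ι → Policy A Z) (π : Policy A Z)
    (hπ : ∀ t s, ∃ i, π.action t s = (pol i).action t s) {k t : ℕ} (hkt : t + k = M.L)
    {s : ℕ → A × Z} {x : Fin C → X} {w : Fin C → ℝ≥0} {a : A}
    (h : M.Accurate g rew ε (V * (2 * ε)) ν t s x w a) :
    ENNReal.ofReal |M.QPAux g π k t s a - M.QMPAux g rew π k t s x w a| +
        ENNReal.ofReal (1 / 10 * lam) ≤
      ENNReal.ofReal (α t + β t) + ENNReal.ofReal (2 * V) *
        M.errTail g rew pol ε (V * (2 * ε)) ν k t s x w a := by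
  have hγ := M.γ_pos
  have hγ1 := M.γ_le_one
  have hrewc : ∀ {t : ℕ} {s : ℕ → A × Z} {x : Fin C → X} {w : Fin C → ℝ≥0} {a : A}, t ≤ M.L →
      M.Accurate g rew ε (V * (2 * ε)) ν t s x w a →
      |∫ y, M.r t y a ∂(M.belief g s t) - particleMean x w (fun y => rew t y a)| ≤
        9 / 10 * lam + ν := by
    intro t s x w a ht h
    have h1 := h.1.abs_reward_sub_le M g hC hε hεV (fun x a => (hR t ht x a).trans (hRV t ht)) hV0.le
    have h2 := abs_particleMean_sub_le x w (f := fun y => M.r t y a) (h := fun y => rew t y a)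
      (fun j => (h.2 j).le) hν
    have h3 := abs_sub_le (∫ y, M.r t y a ∂(M.belief g s t))
      (particleMean x w fun y => M.r t y a) (particleMean x w fun y => rew t y a)
    linarith
  induction k generalizing t s x w a with
  | zero =>
    have ht : t = M.L := by omega
    subst ht
    simp only [QPAux, QMPAux, errTail, mul_zero, add_zero]
    rw [← ENNReal.ofReal_add (abs_nonneg _) (by positivity), hαL, hβL]
    refine ENNReal.ofReal_le_ofReal ?_
    have := hrewc le_rfl h
    linarith
  | succ k ih =>
    have ht : t < M.L := by omega
    have hbd := M.bounds_of_recursion hlam hν hαL hα hβL hβ (k := k) (t := t + 1) (by omega)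
    set c := α (t + 1) + β (t + 1) with hc
    have hc0 : 0 ≤ c := by linarith [hbd.1, hbd.2]
    set f : Z → ℝ := fun z => M.QPAux g π k (t + 1) (Function.update s t (a, z))
      (π.action (t + 1) (Function.update s t (a, z))) with hf
    set h' : Z × (Fin C → X) → ℝ := fun q => M.QMPAux g rew π k (t + 1)
      (Function.update s t (a, q.1)) q.2 (fun j => w j * g.dens (q.2 j) q.1)
      (π.action (t + 1) (Function.update s t (a, q.1))) with hh
    set μ := M.obsLaw g (particleMeasure x w) a with hμ
    set ρ := Measure.pi fun j => M.T (x j, a) with hρ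
    have hμ1 : μ Set.univ ≤ 1 := by
      rw [hμ, M.obsLaw_univ g]; exact particleMeasure_univ_le_one x w
    have hμf : IsFiniteMeasure μ := ⟨hμ1.trans_lt ENNReal.one_lt_top⟩
    have hum : Measurable fun z : Z => Function.update s t (a, z) :=
      measurable_update_snd measurable_const (by fun_prop) t
    have hfm : Measurable f :=
      (M.measurable_QPAux g π k (t + 1)).comp (hum.prodMk ((π.measurable_action _).comp hum))
    have hnext := measurable_next g (fun _ : Unit => π) t () (ω := fun _ => ())
      (S := Z × (Fin C → X)) (s := fun _ => s) (a := fun _ => a) (z := fun q => q.1)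
      (w := fun _ => w) (y := fun q => q.2) measurable_const measurable_const measurable_const
      measurable_fst measurable_const measurable_snd
    have hhm : Measurable h' := (M.measurable_QMPAux g hrew π k (t + 1)).comp hnext.snd
    have hfV : ∀ z, |f z| ≤ V := fun z =>
      (M.abs_QPAux_le g hR0 hR π (k := k) (by omega) _ _).trans (hV (t + 1) ht)
    have hhV : ∀ q, |h' q| ≤ V := fun q =>
      (M.abs_QMPAux_le g hR0 hrewR π (k := k) (by omega) _ _ _ _).trans (hV (t + 1) ht)
    have hfi : Integrable (fun q : Z × (Fin C → X) => f q.1) (μ.prod ρ) :=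
      Integrable.of_bound (hfm.comp measurable_fst).aestronglyMeasurable V
        (ae_of_all _ fun q => hfV q.1)
    have hhi : Integrable h' (μ.prod ρ) :=
      Integrable.of_bound hhm.aestronglyMeasurable V (ae_of_all _ hhV)
    have hffst : ∫ q, f q.1 ∂(μ.prod ρ) = ∫ z, f z ∂μ := by
      rw [integral_fun_fst]; simp
    set D := ∫ q, |f q.1 - h' q| ∂(μ.prod ρ) with hD
    have hD0 : 0 ≤ D := integral_nonneg fun _ => abs_nonneg _
    have hDle : ENNReal.ofReal D ≤ ENNReal.ofReal c + ENNReal.ofReal (2 * V) *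
        M.errTail g rew pol ε (V * (2 * ε)) ν (k + 1) t s x w a := by
      rw [hD, ofReal_integral_eq_lintegral_ofReal (f := fun q => |f q.1 - h' q|) (hfi.sub hhi).abs
        (ae_of_all _ fun _ => abs_nonneg _), errTail_succ, ← hμ, ← hρ]
      refine (lintegral_mono (g := fun q => ENNReal.ofReal c + ENNReal.ofReal (2 * V) * ∑ i,
        M.errBound g rew pol ε (V * (2 * ε)) ν k (t + 1) (Function.update s t (a, q.1)) q.2
          (fun j => w j * g.dens (q.2 j) q.1)
          ((pol i).action (t + 1) (Function.update s t (a, q.1)))) fun q => ?_).trans ?_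
      -- The policy's action is one of those offered, so its term is dominated by the sum over the
      -- family.
      · obtain ⟨i, hi⟩ := hπ (t + 1) (Function.update s t (a, q.1))
        have hsingle := Finset.single_le_sum (f := fun i =>
          M.errBound g rew pol ε (V * (2 * ε)) ν k (t + 1) (Function.update s t (a, q.1)) q.2
          (fun j => w j * g.dens (q.2 j) q.1)
          ((pol i).action (t + 1) (Function.update s t (a, q.1)))) (fun _ _ => zero_le)
          (Finset.mem_univ i)
        refine le_trans ?_ (add_le_add le_rfl (mul_le_mul le_rfl hsingle zero_le zero_le))
        simp only [errBound]
        rw [← hi]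
        -- The slack `λ/10` of the inductive hypothesis is dropped here; only the one at the root is
        -- needed.
        split_ifs with hacc
        · exact le_self_add.trans (ih (by omega) hacc)
        · rw [mul_one]
          refine le_add_left (ENNReal.ofReal_le_ofReal ?_)
          refine (abs_sub _ _).trans ?_
          linarith [hfV q.1, hhV q]
      · rw [lintegral_add_left measurable_const, lintegral_const,
          lintegral_const_mul' _ _ ENNReal.ofReal_ne_top]
        refine add_le_add ?_ le_rfl
        rw [Measure.prod_apply MeasurableSet.univ]
        simp only [Set.preimage_univ, measure_univ, lintegral_const, one_mul]
        exact mul_le_of_le_one_right' hμ1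
    have hobs := h.1.abs_integral_obsLaw_sub_le M g hC hε0 hε ht hfm hV0.le hfV
    have hrw := hrewc ht.le h
    have hsub : |∫ z, f z ∂μ - ∫ q, h' q ∂(μ.prod ρ)| ≤ D := by
      rw [← hffst, ← integral_sub hfi hhi]
      exact abs_integral_le_integral_abs
    have hmain : |M.QPAux g π (k + 1) t s a - M.QMPAux g rew π (k + 1) t s x w a| +
        1 / 10 * lam ≤ (1 + M.γ) * lam + 2 * ν + M.γ * D := by
      rw [QPAux, QMPAux]
      set I1 := ∫ z, f z ∂(M.obsLaw g (M.belief g s t) a)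
      set I2 := ∫ z, f z ∂μ
      set I3 := ∫ q, h' q ∂(μ.prod ρ)
      set r1 := ∫ y, M.r t y a ∂(M.belief g s t)
      set r2 := particleMean x w fun y => rew t y a
      have e : r1 + M.γ * I1 - (r2 + M.γ * I3) = (r1 - r2) + M.γ * ((I1 - I2) + (I2 - I3)) := by
        ring
      have h1 : |r1 + M.γ * I1 - (r2 + M.γ * I3)| ≤ |r1 - r2| + M.γ * (|I1 - I2| + |I2 - I3|) := by
        rw [e]
        refine (abs_add_le _ _).trans (add_le_add le_rfl ?_)
        rw [abs_mul, abs_of_pos hγ]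
        exact mul_le_mul_of_nonneg_left (abs_add_le _ _) hγ.le
      have h2 : |I1 - I2| + |I2 - I3| ≤ lam + D := by
        refine add_le_add (hobs.trans ?_) hsub
        linarith
      have h3 := mul_le_mul_of_nonneg_left h2 hγ.le
      linarith
    rw [← ENNReal.ofReal_add (abs_nonneg _) (by positivity)]
    refine (ENNReal.ofReal_le_ofReal hmain).trans ?_
    have hαβ : α t + β t = ((1 + M.γ) * lam + 2 * ν) + M.γ * c := by
      rw [hα t ht, hβ t ht, hc]; ring
    have hb0 : 0 ≤ (1 + M.γ) * lam + 2 * ν := by positivity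
    rw [hαβ, ENNReal.ofReal_add hb0 (by positivity), ENNReal.ofReal_add hb0 (by positivity), add_assoc,
      ENNReal.ofReal_mul hγ.le, ENNReal.ofReal_mul hγ.le]
    refine add_le_add le_rfl ((mul_le_mul le_rfl hDle zero_le zero_le).trans ?_)
    rw [mul_add]
    exact add_le_add le_rfl (mul_le_of_le_one_left' (ENNReal.ofReal_le_one.2 hγ1))

/-! ### Failure probabilities under the trajectory law -/

variable {Ω : Type*} [MeasurableSpace Ω] {rew : Ω → ℕ → X → A → ℝ}

/-- The law of the reward estimates and of `C` independent particle trajectories up to time `t`. -/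
def jointLaw (P : Measure Ω) (C : ℕ) (s : ℕ → A × Z) (t : ℕ) : Measure (Ω × (Fin C → ℕ → X)) :=
  P.prod (M.particlesLaw C (fun i => (s i).1) t)

instance (P : Measure Ω) [IsProbabilityMeasure P] (C : ℕ) (s : ℕ → A × Z) (t : ℕ) :
    IsProbabilityMeasure (M.jointLaw P C s t) := by
  unfold jointLaw; infer_instance

theorem measurable_section {C : ℕ} (s : ℕ → A × Z) (t : ℕ) (a : A) :
    Measurable fun q : Ω × (Fin C → ℕ → X) =>
      (q.1, s, (particlesAt g s t q.2).1, (particlesAt g s t q.2).2, a) := by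
  have h : Measurable fun q : Ω × (Fin C → ℕ → X) => particlesAt g s t q.2 :=
    (measurable_particlesAt g s t).comp measurable_snd
  exact measurable_fst.prodMk (measurable_const.prodMk
    (h.fst.prodMk (h.snd.prodMk measurable_const)))

/-- A union of the regularity failure and of `C` reward failures. Because the estimates are
independent of the particles, the pointwise bound `D` can be used after conditioning on the
trajectories. -/
theorem jointLaw_not_accurate_le [SFinite vol] (P : Measure Ω) [IsProbabilityMeasure P] {C : ℕ}
    (hC : 0 < C) {d : ℝ} (hd : M.LikelihoodBound g d) (hd0 : 0 < d) {V : ℝ} (hV : 0 < V) {t : ℕ}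
    (ht : t ≤ M.L) (hr : ∀ x a, |M.r t x a| ≤ V)
    (hrew : ∀ t, Measurable fun q : Ω × X × A => rew q.1 t q.2.1 q.2.2) {ν : ℝ} {D : ℝ≥0∞}
    (hD : ∀ x a, P {ω | ν ≤ |M.r t x a - rew ω t x a|} ≤ D) (s : ℕ → A × Z)
    (h0 : M.evidence g s t ≠ 0) (h1 : M.evidence g s t ≠ ∞) (a : A) {ε : ℝ} (hε : 0 ≤ ε) :
    M.jointLaw P C s t {q | ¬ M.Accurate g (rew q.1) ε (V * (2 * ε)) ν t s
        (particlesAt g s t q.2).1 (particlesAt g s t q.2).2 a} ≤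
      ENNReal.ofReal (6 * Real.exp (-(2 * C * ε ^ 2 / d ^ 2))) + C * D := by
  set B : Set (Fin C → ℕ → X) := {x | ¬ M.Regular g ε (V * (2 * ε)) t s
        (particlesAt g s t x).1 (particlesAt g s t x).2 a} with hB
  have hsub : {q : Ω × (Fin C → ℕ → X) | ¬ M.Accurate g (rew q.1) ε (V * (2 * ε)) ν t s
        (particlesAt g s t q.2).1 (particlesAt g s t q.2).2 a} ⊆
      (Set.univ ×ˢ B) ∪ ⋃ j, {q | ν ≤ |M.r t (q.2 j t) a - rew q.1 t (q.2 j t) a|} := by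
    intro q hq
    by_contra hcon
    simp only [Set.mem_union, Set.mem_prod, Set.mem_univ, true_and, Set.mem_iUnion,
      Set.mem_ofPred_eq, not_or, not_exists, not_le, hB, not_not] at hcon
    exact hq ⟨hcon.1, hcon.2⟩
  refine (measure_mono hsub).trans ((measure_union_le _ _).trans (add_le_add ?_ ?_))
  · rw [jointLaw, Measure.prod_prod, measure_univ, one_mul]
    exact M.particlesLaw_not_regular_le g hC hd hd0 hV ht hr s h0 h1 a hε
  · refine (measure_iUnion_le _).trans ?_
    rw [tsum_fintype]
    refine (Finset.sum_le_sum (g := fun _ => D) fun j _ => ?_).trans (by simp)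
    have hm1 : Measurable fun q : Ω × (Fin C → ℕ → X) => M.r t (q.2 j t) a :=
      (M.measurable_r t).comp (by fun_prop : Measurable
        fun q : Ω × (Fin C → ℕ → X) => (q.2 j t, a))
    have hm2 : Measurable fun q : Ω × (Fin C → ℕ → X) => rew q.1 t (q.2 j t) a :=
      (hrew t).comp (by fun_prop : Measurable
        fun q : Ω × (Fin C → ℕ → X) => (q.1, q.2 j t, a))
    have hms : MeasurableSet {q : Ω × (Fin C → ℕ → X) |
        ν ≤ |M.r t (q.2 j t) a - rew q.1 t (q.2 j t) a|} :=
      measurableSet_le measurable_const (hm1.sub hm2).abs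
    rw [jointLaw, Measure.prod_apply_symm hms]
    refine (lintegral_mono (g := fun _ => D) fun x : Fin C → ℕ → X => hD (x j t) a).trans ?_
    simp

/-- The expectation of the error bounds after one more step, given the observation `z`. -/
def errStep {ι : Type*} [Fintype ι] {C : ℕ} (rew : ℕ → X → A → ℝ) (pol : ι → Policy A Z)
    (ε η ν : ℝ) (k t : ℕ) (s : ℕ → A × Z) (x : Fin C → X) (w : Fin C → ℝ≥0) (a : A) (z : Z) :
    ℝ≥0∞ :=
  ∫⁻ y, ∑ i, M.errBound g rew pol ε η ν k (t + 1) (Function.update s t (a, z)) y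
      (fun j => w j * g.dens (y j) z) ((pol i).action (t + 1) (Function.update s t (a, z)))
    ∂(Measure.pi fun j => M.T (x j, a))

theorem measurable_errStep [SFinite vol] {ι : Type*} [Fintype ι] {C : ℕ}
    (hrew : ∀ t, Measurable fun q : Ω × X × A => rew q.1 t q.2.1 q.2.2) (pol : ι → Policy A Z)
    (ε η ν : ℝ) (k t : ℕ) (s : ℕ → A × Z) (a : A) :
    Measurable fun q : (Ω × (Fin C → X) × (Fin C → ℝ≥0)) × Z =>
      M.errStep g (rew q.1.1) pol ε η ν k t s q.1.2.1 q.1.2.2 a q.2 := by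
  refine Measurable.lintegral_kernel_prod_right (κ := (piKernel M.T C).comap
    (fun (q : (Ω × (Fin C → X) × (Fin C → ℝ≥0)) × Z) j => (q.1.2.1 j, a)) (by fun_prop))
    (f := fun q y => ∑ i, M.errBound g (rew q.1.1) pol ε η ν k (t + 1)
      (Function.update s t (a, q.2)) y (fun j => q.1.2.2 j * g.dens (y j) q.2)
      ((pol i).action (t + 1) (Function.update s t (a, q.2)))) ?_
  refine Finset.measurable_sum _ fun i _ => ?_
  exact (M.measurable_errBound g hrew pol ε η ν k (t + 1)).comp (measurable_next g pol t i
    (S := ((Ω × (Fin C → X) × (Fin C → ℝ≥0)) × Z) × (Fin C → X))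
    (ω := fun q => q.1.1.1) (s := fun _ => s) (a := fun _ => a)
    (z := fun q => q.1.2) (w := fun q => q.1.1.2.2) (y := fun q => q.2) (by fun_prop)
    (by fun_prop) (by fun_prop) (by fun_prop) (by fun_prop) (by fun_prop))

/-- The observation and the propagated particles are independent in one transition, so the
observation density factors out as the only place where the current particles influence the law of
`z`. -/
theorem errTail_succ_eq_lintegral [SFinite vol] {ι : Type*} [Fintype ι] {C : ℕ}
    {rew : ℕ → X → A → ℝ} (hrew : ∀ t, Measurable fun q : X × A => rew t q.1 q.2)
    (pol : ι → Policy A Z) (ε η ν : ℝ) (k t : ℕ) (s : ℕ → A × Z) (x : Fin C → X)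
    (w : Fin C → ℝ≥0) (a : A) :
    M.errTail g rew pol ε η ν (k + 1) t s x w a =
      ∫⁻ z, (∫⁻ y, M.nextDens g y a z ∂(particleMeasure x w)) *
        M.errStep g rew pol ε η ν k t s x w a z ∂vol := by
  have hrew' : ∀ t, Measurable fun q : Unit × X × A => rew t q.2.1 q.2.2 := fun t =>
    (hrew t).comp measurable_snd
  have hm : Measurable fun q : Z × (Fin C → X) => ∑ i,
      M.errBound g rew pol ε η ν k (t + 1) (Function.update s t (a, q.1)) q.2
        (fun j => w j * g.dens (q.2 j) q.1)
        ((pol i).action (t + 1) (Function.update s t (a, q.1))) := by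
    refine Finset.measurable_sum _ fun i _ => ?_
    exact (M.measurable_errBound g (rew := fun _ : Unit => rew) hrew' pol ε η ν k (t + 1)).comp (measurable_next g pol t i
      (S := Z × (Fin C → X)) (ω := fun _ => ()) (s := fun _ => s) (a := fun _ => a)
      (z := fun q => q.1) (w := fun _ => w) (y := fun q => q.2) (by fun_prop)
      (by fun_prop) (by fun_prop) (by fun_prop) (by fun_prop) (by fun_prop))
  have hs : Measurable fun z => M.errStep g rew pol ε η ν k t s x w a z :=
    (M.measurable_errStep g (rew := fun _ : Unit => rew) hrew' pol ε η ν k t s a).comp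
      (measurable_prodMk_left (x := (((), x, w) : Unit × (Fin C → X) × (Fin C → ℝ≥0))))
  have : IsFiniteMeasure (M.obsLaw g (particleMeasure x w) a) :=
    ⟨by rw [M.obsLaw_univ g]; exact measure_lt_top _ _⟩
  rw [errTail_succ, lintegral_prod _ hm.aemeasurable, obsLaw_eq]
  exact lintegral_withDensity_eq_lintegral_mul vol
    (M.measurable_lintegral_nextDens_right g _ a) hs

/-- With `z` fixed, averaging over the current particles and their propagation gives the trajectory
law of the extended history, so the induction can continue there. -/
theorem lintegral_errStep [SFinite vol] {ι : Type*} [Fintype ι] {C : ℕ} (P : Measure Ω)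
    [IsProbabilityMeasure P]
    (hrew : ∀ t, Measurable fun q : Ω × X × A => rew q.1 t q.2.1 q.2.2) (pol : ι → Policy A Z)
    (ε η ν : ℝ) (k t : ℕ) (s : ℕ → A × Z) (a : A) (z : Z) :
    ∫⁻ q, M.errStep g (rew q.1) pol ε η ν k t s (particlesAt g s t q.2).1
        (particlesAt g s t q.2).2 a z ∂(M.jointLaw P C s t) =
      ∑ i, ∫⁻ q, M.errBound g (rew q.1) pol ε η ν k (t + 1) (Function.update s t (a, z))
        (particlesAt g (Function.update s t (a, z)) (t + 1) q.2).1
        (particlesAt g (Function.update s t (a, z)) (t + 1) q.2).2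
        ((pol i).action (t + 1) (Function.update s t (a, z)))
        ∂(M.jointLaw P C (Function.update s t (a, z)) (t + 1)) := by
  set s' := Function.update s t (a, z) with hs'
  have hbm : ∀ i, Measurable fun q : Ω × (Fin C → ℕ → X) =>
      M.errBound g (rew q.1) pol ε η ν k (t + 1) s' (particlesAt g s' (t + 1) q.2).1
        (particlesAt g s' (t + 1) q.2).2 ((pol i).action (t + 1) s') := fun i =>
    (M.measurable_errBound g hrew pol ε η ν k (t + 1)).comp (measurable_section g s' (t + 1) _)
  have hm : Measurable fun q : Ω × (Fin C → ℕ → X) =>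
      M.errStep g (rew q.1) pol ε η ν k t s (particlesAt g s t q.2).1
        (particlesAt g s t q.2).2 a z :=
    (M.measurable_errStep g hrew pol ε η ν k t s a).comp
      ((measurable_fst.prodMk ((measurable_particlesAt g s t).comp measurable_snd)).prodMk
        measurable_const)
  rw [← lintegral_finsetSum _ fun i _ => hbm i, jointLaw, jointLaw,
    lintegral_prod _ hm.aemeasurable,
    lintegral_prod _ (Finset.measurable_sum _ fun i _ => hbm i).aemeasurable]
  refine lintegral_congr fun ω => ?_
  refine (M.lintegral_particlesAt_succ g s t a z (f := fun v => ∑ i,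
    M.errBound g (rew ω) pol ε η ν k (t + 1) s' v.1 v.2 ((pol i).action (t + 1) s')) ?_).symm
  refine Finset.measurable_sum _ fun i _ => ?_
  exact (M.measurable_errBound g hrew pol ε η ν k (t + 1)).comp
    (by fun_prop : Measurable fun v : (Fin C → X) × (Fin C → ℝ≥0) =>
      (ω, s', v.1, v.2, (pol i).action (t + 1) s'))

-- By Fubini, fix `z` first. On accurate particle beliefs the particle density is at most `2d` times
-- the predictive density, which does not depend on the particles; the remaining average is a sum
-- over `ι` of expected `errBound` at the extended history. Each of those is at most `Q` plus the
-- inductive bound, and the predictive density integrates to one. Each step thus contributes a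
-- factor `2d|ι|`.
open Classical in
theorem lintegral_errTail_le [SFinite vol] {ι : Type*} [Fintype ι] {C : ℕ} (hC : 0 < C)
    (P : Measure Ω) [IsProbabilityMeasure P] {d : ℝ} (hd : M.LikelihoodBound g d)
    (hrew : ∀ t, Measurable fun q : Ω × X × A => rew q.1 t q.2.1 q.2.2) (pol : ι → Policy A Z)
    {ε η ν : ℝ} (hε : ε ≤ 3 / 8) {Q : ℝ≥0∞}
    (hQ : ∀ t ≤ M.L, ∀ s : ℕ → A × Z, M.evidence g s t ≠ 0 → M.evidence g s t ≠ ∞ → ∀ a,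
      M.jointLaw P C s t {q | ¬ M.Accurate g (rew q.1) ε η ν t s
        (particlesAt g s t q.2).1 (particlesAt g s t q.2).2 a} ≤ Q) {k t : ℕ}
    (hkt : t + k = M.L) (s : ℕ → A × Z) (h0 : M.evidence g s t ≠ 0)
    (h1 : M.evidence g s t ≠ ∞) (a : A) :
    ∫⁻ q, (if M.Accurate g (rew q.1) ε η ν t s
        (particlesAt g s t q.2).1 (particlesAt g s t q.2).2 a then
        M.errTail g (rew q.1) pol ε η ν k t s
        (particlesAt g s t q.2).1 (particlesAt g s t q.2).2 a else 0) ∂(M.jointLaw P C s t) ≤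
      Q * ∑ l ∈ Finset.range k, (2 * ENNReal.ofReal d * Fintype.card ι) ^ (l + 1) := by
  induction k generalizing t s a with
  | zero => simp [errTail]
  | succ k ih =>
    have ht : t < M.L := by omega
    set y := 2 * ENNReal.ofReal d * Fintype.card ι with hy
    set K := Q * ∑ l ∈ Finset.range (k + 1), y ^ l with hK
    -- the bound for `errBound` one step later
    have hnext : ∀ s : ℕ → A × Z, M.evidence g s (t + 1) ≠ 0 → M.evidence g s (t + 1) ≠ ∞ → ∀ a,
        ∫⁻ q, M.errBound g (rew q.1) pol ε η ν k (t + 1) s (particlesAt g s (t + 1) q.2).1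
          (particlesAt g s (t + 1) q.2).2 a ∂(M.jointLaw P C s (t + 1)) ≤ K := by
      intro s h0 h1 a
      have hacc : MeasurableSet {q : Ω × (Fin C → ℕ → X) | ¬ M.Accurate g (rew q.1) ε η ν (t + 1) s
          (particlesAt g s (t + 1) q.2).1 (particlesAt g s (t + 1) q.2).2 a} :=
        ((M.measurableSet_accurate g hrew ε η ν (t + 1)).preimage
          (measurable_section g s (t + 1) a)).compl
      have hsplit : ∀ q : Ω × (Fin C → ℕ → X),
          M.errBound g (rew q.1) pol ε η ν k (t + 1) s (particlesAt g s (t + 1) q.2).1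
          (particlesAt g s (t + 1) q.2).2 a =
          Set.indicator {q : Ω × (Fin C → ℕ → X) | ¬ M.Accurate g (rew q.1) ε η ν (t + 1) s
          (particlesAt g s (t + 1) q.2).1 (particlesAt g s (t + 1) q.2).2 a} 1 q +
          (if M.Accurate g (rew q.1) ε η ν (t + 1) s
            (particlesAt g s (t + 1) q.2).1 (particlesAt g s (t + 1) q.2).2 a then
            M.errTail g (rew q.1) pol ε η ν k (t + 1) s
            (particlesAt g s (t + 1) q.2).1 (particlesAt g s (t + 1) q.2).2 a else 0) := by
        intro q
        by_cases h : M.Accurate g (rew q.1) ε η ν (t + 1) s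
            (particlesAt g s (t + 1) q.2).1 (particlesAt g s (t + 1) q.2).2 a <;>
          simp [errBound, h]
      simp only [hsplit]
      rw [lintegral_add_left (measurable_one.indicator hacc), lintegral_indicator_one hacc, hK,
        Finset.sum_range_succ', mul_add, add_comm]
      refine add_le_add (ih (by omega) s h0 h1 a) ?_
      simpa using hQ (t + 1) ht s h0 h1 a
    have hrew1 : ∀ ω, ∀ t, Measurable fun q : X × A => rew ω t q.1 q.2 := fun ω t =>
      (hrew t).comp measurable_prodMk_left
    have hset : MeasurableSet {q : Ω × (Fin C → ℕ → X) | M.Accurate g (rew q.1) ε η ν t s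
        (particlesAt g s t q.2).1 (particlesAt g s t q.2).2 a} :=
      (M.measurableSet_accurate g hrew ε η ν t).preimage (measurable_section g s t a)
    set F : Ω × (Fin C → ℕ → X) → Z → ℝ≥0∞ := fun q z =>
      (if M.Accurate g (rew q.1) ε η ν t s
        (particlesAt g s t q.2).1 (particlesAt g s t q.2).2 a then
        ∫⁻ y, M.nextDens g y a z ∂(particleMeasure (particlesAt g s t q.2).1
          (particlesAt g s t q.2).2) else 0) *
        M.errStep g (rew q.1) pol ε η ν k t s (particlesAt g s t q.2).1
          (particlesAt g s t q.2).2 a z with hF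
    have hpm : Measurable fun q : (Ω × (Fin C → ℕ → X)) × Z => particlesAt g s t q.1.2 :=
      (measurable_particlesAt g s t).comp (measurable_snd.comp measurable_fst)
    have hstep : Measurable fun q : (Ω × (Fin C → ℕ → X)) × Z =>
        M.errStep g (rew q.1.1) pol ε η ν k t s (particlesAt g s t q.1.2).1
          (particlesAt g s t q.1.2).2 a q.2 :=
      (M.measurable_errStep g hrew pol ε η ν k t s a).comp
        (((measurable_fst.comp measurable_fst).prodMk hpm).prodMk measurable_snd)
    have hFm : Measurable (Function.uncurry F) := by
      refine Measurable.mul (Measurable.ite (hset.preimage measurable_fst) ?_ measurable_const) hstep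
      exact M.measurable_lintegral_nextDens g ((particleKernel X C).comap _ hpm)
        measurable_const measurable_snd
    have hle : ∀ q, (if M.Accurate g (rew q.1) ε η ν t s
        (particlesAt g s t q.2).1 (particlesAt g s t q.2).2 a then
        M.errTail g (rew q.1) pol ε η ν (k + 1) t s
        (particlesAt g s t q.2).1 (particlesAt g s t q.2).2 a else 0) ≤ ∫⁻ z, F q z ∂vol := by
      intro q
      split_ifs with h
      · rw [M.errTail_succ_eq_lintegral g (hrew1 q.1)]
        simp only [hF, h, if_true]
        exact le_rfl
      · exact zero_le
    refine (lintegral_mono hle).trans ?_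
    rw [lintegral_lintegral_swap hFm.aemeasurable]
    have hz : ∀ᵐ z ∂vol, ∫⁻ q, F q z ∂(M.jointLaw P C s t) ≤ M.predDens g s t a z * (y * K) := by
      filter_upwards [M.predDens_ae_lt_top g s t a] with z hz
      have hae : ∀ᵐ q ∂(M.jointLaw P C s t), ∀ j,
          ((particlesAt g s t q.2).2 j : ℝ≥0∞) * M.nextDens g ((particlesAt g s t q.2).1 j) a z ≤
          ENNReal.ofReal d * (M.evidence g s t * M.predDens g s t a z) := by
        rw [ae_all_iff]
        intro j
        have hmp : MeasurePreserving (fun q : Ω × (Fin C → ℕ → X) => q.2 j) (M.jointLaw P C s t)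
            (M.pathLaw (fun i => (s i).1) t) :=
          (measurePreserving_eval (fun _ : Fin C => M.pathLaw (fun i => (s i).1) t) j).comp
            measurePreserving_snd
        exact hmp.quasiMeasurePreserving.ae (M.lik_mul_nextDens_le g hd ht s a z h0 h1)
      have hb : ∫⁻ q, F q z ∂(M.jointLaw P C s t) ≤
          ∫⁻ q, (2 * ENNReal.ofReal d * M.predDens g s t a z) *
            M.errStep g (rew q.1) pol ε η ν k t s (particlesAt g s t q.2).1
              (particlesAt g s t q.2).2 a z ∂(M.jointLaw P C s t) := by
        refine lintegral_mono_ae ?_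
        filter_upwards [hae] with q hq
        simp only [hF]
        refine mul_le_mul ?_ le_rfl zero_le zero_le
        split_ifs with h
        · exact h.1.particleDens_le M g hC hε hq
        · exact zero_le
      refine hb.trans ?_
      have hstep_z : Measurable fun q : Ω × (Fin C → ℕ → X) =>
          M.errStep g (rew q.1) pol ε η ν k t s (particlesAt g s t q.2).1
            (particlesAt g s t q.2).2 a z := hstep.comp measurable_prodMk_right
      rw [lintegral_const_mul _ hstep_z, M.lintegral_errStep g P hrew]
      -- If the predictive density vanishes, the extended history has evidence zero and the
      -- inductive bound is unavailable, but the prefactor is zero as well.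
      by_cases hz0 : M.predDens g s t a z = 0
      · simp [hz0]
      · have he := M.evidence_succ_eq_mul g s t a z h0 h1
        have hsum : ∑ i, ∫⁻ q, M.errBound g (rew q.1) pol ε η ν k (t + 1)
            (Function.update s t (a, z))
            (particlesAt g (Function.update s t (a, z)) (t + 1) q.2).1
            (particlesAt g (Function.update s t (a, z)) (t + 1) q.2).2
            ((pol i).action (t + 1) (Function.update s t (a, z)))
            ∂(M.jointLaw P C (Function.update s t (a, z)) (t + 1)) ≤ Fintype.card ι * K := by
          refine (Finset.sum_le_sum fun i _ => hnext _ ?_ ?_ _).trans (by simp)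
          · rw [he]; exact mul_ne_zero h0 hz0
          · rw [he]; exact ENNReal.mul_ne_top h1 hz.ne
        refine (mul_le_mul le_rfl hsum zero_le zero_le).trans (le_of_eq ?_)
        rw [hy]; ring
    refine (lintegral_mono_ae hz).trans ?_
    have hpred : Measurable fun z => M.predDens g s t a z :=
      M.measurable_predDens g t measurable_const measurable_const measurable_id
    rw [lintegral_mul_const _ hpred, M.lintegral_predDens g s t a h0 h1, one_mul, hK]
    refine le_of_eq ?_
    rw [mul_left_comm, Finset.mul_sum]
    simp only [← pow_succ']

theorem measure_particlesAt_mono {C : ℕ} (P : Measure Ω) [IsProbabilityMeasure P]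
    (s : ℕ → A × Z) {t n : ℕ} (htn : t ≤ n)
    {B : Set (Ω × (Fin C → X) × (Fin C → ℝ≥0))} (hB : MeasurableSet B) :
    M.jointLaw P C s n {q | (q.1, particlesAt g s t q.2) ∈ B} =
      M.jointLaw P C s t {q | (q.1, particlesAt g s t q.2) ∈ B} := by
  have hm : MeasurableSet {q : Ω × (Fin C → ℕ → X) | (q.1, particlesAt g s t q.2) ∈ B} :=
    hB.preimage (measurable_fst.prodMk ((measurable_particlesAt g s t).comp measurable_snd))
  rw [jointLaw, jointLaw, Measure.prod_apply hm, Measure.prod_apply hm]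
  refine lintegral_congr fun ω => ?_
  have hBω : MeasurableSet (Prod.mk ω ⁻¹' B) := hB.preimage measurable_prodMk_left
  have hpre : ∀ m, M.particlesLaw C (fun i => (s i).1) m
      (Prod.mk ω ⁻¹' {q : Ω × (Fin C → ℕ → X) | (q.1, particlesAt g s t q.2) ∈ B}) =
      ∫⁻ x, (Prod.mk ω ⁻¹' B).indicator 1 (particlesAt g s t x)
        ∂(M.particlesLaw C (fun i => (s i).1) m) := by
    intro m
    rw [← lintegral_indicator_one (hm.preimage measurable_prodMk_left)]
    rfl
  rw [hpre, hpre]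
  exact M.lintegral_particlesAt_mono g s htn (measurable_one.indicator hBω) _

/-- Markov's inequality for `errTail` on accurate particle beliefs, plus the probability that the
root is not accurate. The event is read off from the first `t` steps, so trajectories up to `n` can
be replaced by trajectories up to `t`. -/
theorem jointLaw_failure_le [SFinite vol] {ι : Type*} [Fintype ι] {C : ℕ} (hC : 0 < C)
    (P : Measure Ω) [IsProbabilityMeasure P] {d : ℝ} (hd : M.LikelihoodBound g d)
    (hrew : ∀ t, Measurable fun q : Ω × X × A => rew q.1 t q.2.1 q.2.2) (pol : ι → Policy A Z)
    {ε η ν : ℝ} (hε : ε ≤ 3 / 8) {Q : ℝ≥0∞}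
    (hQ : ∀ t ≤ M.L, ∀ s : ℕ → A × Z, M.evidence g s t ≠ 0 → M.evidence g s t ≠ ∞ → ∀ a,
      M.jointLaw P C s t {q | ¬ M.Accurate g (rew q.1) ε η ν t s
        (particlesAt g s t q.2).1 (particlesAt g s t q.2).2 a} ≤ Q) {k t n : ℕ}
    (hkt : t + k = M.L) (htn : t ≤ n) (s : ℕ → A × Z) (h0 : M.evidence g s t ≠ 0)
    (h1 : M.evidence g s t ≠ ∞) (a : A) {c : ℝ≥0∞} (hc : c ≠ 0) (hc' : c ≠ ∞) :
    M.jointLaw P C s n {q | ¬ (M.Accurate g (rew q.1) ε η ν t s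
        (particlesAt g s t q.2).1 (particlesAt g s t q.2).2 a ∧
        M.errTail g (rew q.1) pol ε η ν k t s
        (particlesAt g s t q.2).1 (particlesAt g s t q.2).2 a ≤ c)} ≤
      Q + Q * (∑ l ∈ Finset.range k, (2 * ENNReal.ofReal d * Fintype.card ι) ^ (l + 1)) / c := by
  classical
  have hsec : Measurable fun v : Ω × (Fin C → X) × (Fin C → ℝ≥0) => (v.1, s, v.2.1, v.2.2, a) := by
    fun_prop
  have hB : MeasurableSet {v : Ω × (Fin C → X) × (Fin C → ℝ≥0) |
      ¬ (M.Accurate g (rew v.1) ε η ν t s v.2.1 v.2.2 a ∧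
        M.errTail g (rew v.1) pol ε η ν k t s v.2.1 v.2.2 a ≤ c)} := by
    refine MeasurableSet.compl (MeasurableSet.inter
      ((M.measurableSet_accurate g hrew ε η ν t).preimage hsec) ?_)
    exact measurableSet_le ((M.measurable_errTail g hrew pol ε η ν k t).comp hsec)
      measurable_const
  refine (M.measure_particlesAt_mono g P s htn hB).le.trans ?_
  set G : Ω × (Fin C → ℕ → X) → ℝ≥0∞ := fun q => if M.Accurate g (rew q.1) ε η ν t s
        (particlesAt g s t q.2).1 (particlesAt g s t q.2).2 a then
        M.errTail g (rew q.1) pol ε η ν k t s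
        (particlesAt g s t q.2).1 (particlesAt g s t q.2).2 a else 0 with hG
  have hGm : Measurable G := by
    refine Measurable.ite ((M.measurableSet_accurate g hrew ε η ν t).preimage
      (measurable_section g s t a)) ?_ measurable_const
    exact (M.measurable_errTail g hrew pol ε η ν k t).comp (measurable_section g s t a)
  have hsub : {q : Ω × (Fin C → ℕ → X) | (q.1, particlesAt g s t q.2) ∈
      {v : Ω × (Fin C → X) × (Fin C → ℝ≥0) |
      ¬ (M.Accurate g (rew v.1) ε η ν t s v.2.1 v.2.2 a ∧
        M.errTail g (rew v.1) pol ε η ν k t s v.2.1 v.2.2 a ≤ c)}} ⊆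
      {q | ¬ M.Accurate g (rew q.1) ε η ν t s
        (particlesAt g s t q.2).1 (particlesAt g s t q.2).2 a} ∪ {q | c ≤ G q} := by
    intro q hq
    by_cases h : M.Accurate g (rew q.1) ε η ν t s
        (particlesAt g s t q.2).1 (particlesAt g s t q.2).2 a
    · right
      have h2 : ¬ M.errTail g (rew q.1) pol ε η ν k t s
        (particlesAt g s t q.2).1 (particlesAt g s t q.2).2 a ≤ c := fun h' => hq ⟨h, h'⟩
      simp only [Set.mem_ofPred_eq, hG, h, if_true]
      exact (not_le.1 h2).le
    · exact Or.inl h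
  refine (measure_mono hsub).trans ((measure_union_le _ _).trans
    (add_le_add (hQ t (by omega) s h0 h1 a) ?_))
  refine (meas_ge_le_lintegral_div hGm.aemeasurable hc hc').trans (ENNReal.div_le_div_right ?_ _)
  exact M.lintegral_errTail_le g hC P hd hrew pol hε hQ hkt s h0 h1 a

end POMDP

/-! ### Constants and union bounds -/

/-- Each of the `k` terms is at most `10 q R ^ L`, where only one factor `y` carries the division by
the small threshold `c`. -/
theorem add_mul_sum_pow_div_le {q y c R : ℝ} (hq : 0 ≤ q) (hy : 0 ≤ y) (hc : 0 < c) (hR : 1 ≤ R)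
    (hyR : y ≤ R) (hyc : y / c ≤ 10 * R) {k L : ℕ} (hk : k ≤ L) :
    q + q * (∑ l ∈ Finset.range k, y ^ (l + 1)) / c ≤ 10 * q * (L + 1) * R ^ L := by
  have h1 : (∑ l ∈ Finset.range k, y ^ (l + 1)) / c ≤ k * (10 * R ^ L) := by
    rw [Finset.sum_div]
    refine (Finset.sum_le_sum (g := fun _ => 10 * R ^ L) fun l hl => ?_).trans (by simp)
    have h2 : y ^ (l + 1) / c = y ^ l * (y / c) := by rw [pow_succ]; ring
    rw [h2]
    calc y ^ l * (y / c) ≤ R ^ l * (10 * R) :=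
          mul_le_mul (pow_le_pow_left₀ hy hyR _) hyc (by positivity) (by positivity)
      _ = 10 * R ^ (l + 1) := by ring
      _ ≤ 10 * R ^ L := by
          have := pow_le_pow_right₀ hR (show l + 1 ≤ L by have := Finset.mem_range.1 hl; omega)
          linarith
  have hRL : 1 ≤ R ^ L := one_le_pow₀ hR
  have hkL : (k : ℝ) ≤ L := by exact_mod_cast hk
  have h3 : (k : ℝ) * (10 * R ^ L) ≤ L * (10 * R ^ L) := by gcongr
  rw [mul_div_assoc]
  have h4 := mul_le_mul_of_nonneg_left (h1.trans h3) hq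
  nlinarith [mul_le_mul_of_nonneg_left hRL hq]

/-- The two factors `L + 1`, from the times and from the steps of the tree, are absorbed by `(L +
1)² ≤ 4 ^ L`, and `C ≥ 3` gives `6e + Cδ ≤ 2C(e + δ)`. -/
theorem union_bound_le {e δ m C : ℝ} (he : 0 ≤ e) (hδ : 0 ≤ δ) (hm : 1 ≤ m) (hC : 3 ≤ C)
    {n L : ℕ} (hn : n ≤ L) :
    (n + 1) * (m * (10 * (6 * e + C * δ) * (L + 1) * (C * m) ^ L)) ≤
      5 * (4 * m * C) ^ (L + 1) * (e + δ) := by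
  have hnL : (n : ℝ) ≤ L := by exact_mod_cast hn
  have h1 : 6 * e + C * δ ≤ 2 * C * (e + δ) := by
    have h3 := mul_nonneg he (sub_nonneg.2 hC)
    have h4 := mul_nonneg hδ (zero_le_three.trans hC)
    linarith
  have h2 : ((L : ℝ) + 1) ^ 2 ≤ 4 ^ L := by
    have : L + 1 ≤ 2 ^ L := Nat.lt_two_pow_self
    have h3 : ((L : ℝ) + 1) ≤ 2 ^ L := by exact_mod_cast this
    calc ((L : ℝ) + 1) ^ 2 ≤ (2 ^ L) ^ 2 := by gcongr
      _ = 4 ^ L := by rw [← pow_mul, mul_comm, pow_mul]; norm_num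
  calc (n + 1) * (m * (10 * (6 * e + C * δ) * (L + 1) * (C * m) ^ L))
      ≤ (L + 1) * (m * (10 * (2 * C * (e + δ)) * (L + 1) * (C * m) ^ L)) := by
        gcongr
    _ = ((L : ℝ) + 1) ^ 2 * (20 * (m * C) ^ (L + 1) * (e + δ)) := by ring
    _ ≤ 4 ^ L * (20 * (m * C) ^ (L + 1) * (e + δ)) := by gcongr
    _ = 5 * (4 * m * C) ^ (L + 1) * (e + δ) := by
        rw [mul_assoc 4 m C, mul_pow 4 (m * C)]; ring

theorem measure_biUnion_range_iUnion_le {E ι : Type*} [MeasurableSpace E] [Fintype ι]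
    (μ : Measure E) (B : ℕ → ι → Set E) {n : ℕ} {K : ℝ}
    (hB : ∀ t ≤ n, ∀ i, μ (B t i) ≤ ENNReal.ofReal K) :
    μ (⋃ t ∈ Finset.range (n + 1), ⋃ i, B t i) ≤
      ENNReal.ofReal ((n + 1) * (Fintype.card ι * K)) := by
  calc μ (⋃ t ∈ Finset.range (n + 1), ⋃ i, B t i)
      ≤ ∑ t ∈ Finset.range (n + 1), μ (⋃ i, B t i) := measure_biUnion_finset_le _ _
    _ ≤ ∑ _t ∈ Finset.range (n + 1), ∑ _i : ι, ENNReal.ofReal K := by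
        refine Finset.sum_le_sum fun t ht => (measure_iUnion_le _).trans ?_
        rw [tsum_fintype]
        exact Finset.sum_le_sum fun i _ => hB t (Nat.lt_succ_iff.1 (Finset.mem_range.1 ht)) i
    _ = ENNReal.ofReal ((n + 1) * (Fintype.card ι * K)) := by
        rw [← Nat.cast_succ, ENNReal.ofReal_mul (Nat.cast_nonneg _),
          ENNReal.ofReal_mul (Nat.cast_nonneg _), ENNReal.ofReal_natCast, ENNReal.ofReal_natCast]
        simp only [Finset.sum_const, Finset.card_univ, Finset.card_range, nsmul_eq_mul]

/-! ### The good event -/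

namespace POMDP

variable {X A Z : Type*} [MeasurableSpace X] [MeasurableSpace A] [MeasurableSpace Z]
variable (M : POMDP X A) {vol : Measure Z} (g : ObsDensity X vol)

theorem LikelihoodBound.one_le {d : ℝ} (hd : M.LikelihoodBound g d) (s : ℕ → A × Z) : 1 ≤ d := by
  obtain ⟨p, hp⟩ := (hd 0 (Nat.zero_le _) s).exists
  simpa [ObsDensity.lik, evidence] using hp

theorem le_VmaxAt {Rmax : ℕ → ℝ} (hR0 : ∀ t ≤ M.L, 0 ≤ Rmax t) {t : ℕ} (ht : t ≤ M.L) :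
    Rmax t ≤ M.VmaxAt Rmax t := by
  rcases ht.eq_or_lt with rfl | h
  · rw [VmaxAt_horizon]
  · rw [M.VmaxAt_step Rmax h]
    linarith [mul_nonneg M.γ_pos.le (M.VmaxAt_nonneg hR0 (t + 1))]

-- The family `pol` offers the actions at later nodes and `root` those queried at the given history.
-- Since `errTail` already sums over the family, one event serves every policy that always picks an
-- offered action.
set_option maxHeartbeats 1000000 in
theorem exists_event [SFinite vol] {Ω : Type*} [MeasurableSpace Ω] (P : Measure Ω)
    [IsProbabilityMeasure P] {Rmax : ℕ → ℝ} (hR : ∀ t ≤ M.L, ∀ x a, |M.r t x a| ≤ Rmax t)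
    {d : ℝ} (hd : M.LikelihoodBound g d) {rew : Ω → ℕ → X → A → ℝ}
    (hrew : ∀ t, Measurable fun q : Ω × X × A => rew q.1 t q.2.1 q.2.2)
    (hrewR : ∀ ω, ∀ t ≤ M.L, ∀ x a, |rew ω t x a| ≤ Rmax t) {ν δ : ℝ} (hν : 0 ≤ ν)
    (hδ : ∀ t ≤ M.L, ∀ x a, P.real {ω | ν ≤ |M.r t x a - rew ω t x a|} ≤ δ)
    {C : ℕ} (hC : 0 < C) {lam : ℝ} (hlam : 0 ≤ lam) (hk : 0 < M.kMax Rmax d lam C)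
    {α β : ℕ → ℝ}
    (hαL : α M.L = lam) (hα : ∀ t < M.L, α t = (1 + M.γ) * lam + M.γ * α (t + 1))
    (hβL : β M.L = 2 * ν) (hβ : ∀ t < M.L, β t = 2 * ν + M.γ * β (t + 1))
    {n : ℕ} (hn : n ≤ M.L) (s : ℕ → A × Z)
    (hs : ∀ t ≤ n, M.evidence g s t ≠ 0 ∧ M.evidence g s t ≠ ∞)
    {ι : Type*} [Fintype ι] [Nonempty ι] (pol : ι → Policy A Z) (root : ι → ℕ → A) :
    ∃ E : Set (Ω × (Fin C → ℕ → X)), MeasurableSet E ∧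
      1 - 5 * (4 * (Fintype.card ι : ℝ) * (C : ℝ)) ^ (M.L + 1) *
          (Real.exp (-(C * M.kAcute Rmax d lam C ^ 2)) + δ) ≤ (M.jointLaw P C s n).real E ∧
      ∀ q ∈ E, ∀ π : Policy A Z, (∀ t s, ∃ i, π.action t s = (pol i).action t s) →
        ∀ t ≤ n, ∀ i,
          |M.QP g π t s (root i t) - M.QMP g (rew q.1) π t s q.2 (root i t)| ≤ α t + β t := by
  have hXne : Nonempty X := M.b0.nonempty_of_neZero
  have x0 : X := hXne.some
  have a0 : A := (s 0).1
  have hR0 : ∀ t ≤ M.L, 0 ≤ Rmax t := fun t ht => (abs_nonneg _).trans (hR t ht x0 a0)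
  have hδ0 : 0 ≤ δ := measureReal_nonneg.trans (hδ 0 (Nat.zero_le _) x0 a0)
  set V := M.Vmax Rmax with hVdef
  have hV : ∀ t ≤ M.L, M.VmaxAt Rmax t ≤ V := fun t ht => M.VmaxAt_le_Vmax Rmax ht
  have hRV : ∀ t ≤ M.L, Rmax t ≤ V := fun t ht => (M.le_VmaxAt hR0 ht).trans (hV t ht)
  have hd1 : 1 ≤ d := hd.one_le M g s
  have hd0 : 0 < d := by linarith
  have hCr : (0 : ℝ) < C := by exact_mod_cast hC
  have hsC : 0 < √(C : ℝ) := Real.sqrt_pos.2 hCr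
  have hV0' : 0 ≤ V := (hR0 0 (Nat.zero_le _)).trans (hRV 0 (Nat.zero_le _))
  have hkm : 1 / √(C : ℝ) < lam / (4 * V * d) := by
    have := hk; unfold kMax at this; linarith
  have hVd : 0 < lam / (4 * V * d) := lt_trans (by positivity) hkm
  have hV0 : 0 < V := by
    refine lt_of_le_of_ne hV0' fun h => ?_
    rw [← h] at hVd
    simp at hVd
  have hlam0 : 0 < lam := by
    refine lt_of_le_of_ne hlam fun h => ?_
    rw [← h] at hVd
    simp at hVd
  have hαβ : ∀ t ≤ M.L, lam ≤ α t ∧ 0 ≤ β t := fun t ht =>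
    M.bounds_of_recursion hlam hν hαL hα hβL hβ (k := M.L - t) (by omega)
  have hrew1 : ∀ ω, ∀ t, Measurable fun q : X × A => rew ω t q.1 q.2 := fun ω t =>
    (hrew t).comp measurable_prodMk_left
  set e := Real.exp (-(C * M.kAcute Rmax d lam C ^ 2)) with he
  have he0 : 0 < e := Real.exp_pos _
  -- Values lie in `[-V, V]`, so for `λ ≥ 2V` the bound holds everywhere. Otherwise `λ < 2V`, which
  -- is what makes `ε` small and, through `k_max > 0`, makes `C` large.
  by_cases hbig : 2 * V ≤ lam
  · refine ⟨Set.univ, MeasurableSet.univ, ?_, fun q _ π _ t ht i => ?_⟩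
    · have : 0 ≤ 5 * (4 * (Fintype.card ι : ℝ) * (C : ℝ)) ^ (M.L + 1) * (e + δ) := by positivity
      simp only [probReal_univ]
      linarith
    · have htL := ht.trans hn
      have h1 := (M.abs_QPAux_le g hR0 hR π (k := M.L - t) (t := t) (by omega) s
        (root i t)).trans (hV t htL)
      have h2 := (M.abs_QMPAux_le g hR0 (hrewR q.1) π (k := M.L - t) (t := t) (by omega) s
        (fun j => q.2 j t) (fun j => g.lik s t (q.2 j)) (root i t)).trans (hV t htL)
      have h3 := hαβ t htL
      unfold QP QMP
      refine (abs_sub _ _).trans ?_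
      linarith
  · rw [not_le] at hbig
    set kA := M.kAcute Rmax d lam C with hkA
    have hkA0 : 0 < kA := lt_min hk (by positivity)
    have hkA1 : kA ≤ lam / (4 * V * d) := by
      have h1 : kA ≤ M.kMax Rmax d lam C := min_le_left _ _
      have h2 : M.kMax Rmax d lam C ≤ lam / (4 * V * d) := by
        unfold kMax
        linarith [show 0 < 1 / √(C : ℝ) by positivity]
      exact h1.trans h2
    have hkA2 : kA * (4 * V * d) ≤ lam := (le_div_iff₀ (by positivity)).1 hkA1
    have hCs : 4 * V * d < lam * √(C : ℝ) := by
      rw [div_lt_div_iff₀ hsC (by positivity)] at hkm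
      linarith
    have h2d : 2 * d < √(C : ℝ) := by
      by_contra hcon
      rw [not_lt] at hcon
      nlinarith
    have hCbig : 4 < (C : ℝ) := by
      have h := Real.sq_sqrt hCr.le
      nlinarith
    have hsCC : √(C : ℝ) ≤ C := by
      have h := Real.sq_sqrt hCr.le
      nlinarith
    -- Small enough that `kA ≤ λ/(4Vd)` gives `εV ≤ 3λ/16`, and large enough that the exponent
    -- `2Cε²/d² = (9/8) C kA²` still exceeds `C kA²`.
    set ε := 3 / 4 * (d * kA) with hε
    have hε0 : 0 ≤ ε := by positivity
    have hεV : ε * V ≤ 3 / 16 * lam := by rw [hε]; linarith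
    have hε1 : ε ≤ 3 / 8 := by
      by_contra hcon
      rw [not_le] at hcon
      nlinarith
    set m : ℝ := (Fintype.card ι : ℝ) with hm
    have hm1 : 1 ≤ m := by
      rw [hm]; exact_mod_cast Fintype.card_pos
    -- Chosen so that `2V` times the threshold is exactly the slack `λ/10`.
    set c : ℝ := lam / (20 * V) with hc
    have hc0 : 0 < c := by positivity
    set q₀ : ℝ := 6 * e + C * δ with hq
    have hq0 : 0 ≤ q₀ := by positivity
    have hQ : ∀ t ≤ M.L, ∀ s : ℕ → A × Z, M.evidence g s t ≠ 0 → M.evidence g s t ≠ ∞ → ∀ a,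
        M.jointLaw P C s t {q | ¬ M.Accurate g (rew q.1) ε (V * (2 * ε)) ν t s
          (particlesAt g s t q.2).1 (particlesAt g s t q.2).2 a} ≤ ENNReal.ofReal q₀ := by
      intro t ht s h0 h1 a
      refine (M.jointLaw_not_accurate_le g P hC hd hd0 hV0 ht
        (fun x a => (hR t ht x a).trans (hRV t ht)) hrew (D := ENNReal.ofReal δ) (fun x a => ?_)
        s h0 h1 a hε0).trans ?_
      · rw [← ENNReal.ofReal_toReal (measure_ne_top P _)]
        exact ENNReal.ofReal_le_ofReal (hδ t ht x a)
      · rw [hq, ENNReal.ofReal_add (by positivity) (by positivity), ENNReal.ofReal_mul hCr.le,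
          ENNReal.ofReal_natCast]
        refine add_le_add (ENNReal.ofReal_le_ofReal ?_) le_rfl
        refine mul_le_mul_of_nonneg_left (Real.exp_le_exp.2 (neg_le_neg ?_)) (by norm_num)
        have h2 : 2 * C * ε ^ 2 / d ^ 2 = 9 / 8 * (C * kA ^ 2) := by
          rw [hε]; field_simp; ring
        rw [h2]
        have : 0 ≤ (C : ℝ) * kA ^ 2 := by positivity
        linarith
    set Bad : ℕ → ι → Set (Ω × (Fin C → ℕ → X)) := fun t i =>
      {q | ¬ (M.Accurate g (rew q.1) ε (V * (2 * ε)) ν t s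
        (particlesAt g s t q.2).1 (particlesAt g s t q.2).2 (root i t) ∧
        M.errTail g (rew q.1) pol ε (V * (2 * ε)) ν (M.L - t) t s
        (particlesAt g s t q.2).1 (particlesAt g s t q.2).2 (root i t) ≤ ENNReal.ofReal c)}
      with hBad
    have hBadle : ∀ t ≤ n, ∀ i, M.jointLaw P C s n (Bad t i) ≤
        ENNReal.ofReal (10 * q₀ * (M.L + 1) * (C * m) ^ M.L) := by
      intro t ht i
      refine (M.jointLaw_failure_le g hC P hd hrew pol hε1 hQ (k := M.L - t) (by omega) ht s
        (hs t ht).1 (hs t ht).2 (root i t) (c := ENNReal.ofReal c)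
        (ENNReal.ofReal_pos.2 hc0).ne' ENNReal.ofReal_ne_top).trans ?_
      have hy : 2 * ENNReal.ofReal d * (Fintype.card ι : ℝ≥0∞) = ENNReal.ofReal (2 * d * m) := by
        rw [ENNReal.ofReal_mul (by positivity), ENNReal.ofReal_mul (by norm_num), hm,
          ENNReal.ofReal_natCast, ENNReal.ofReal_ofNat]
      have hy0 : 0 ≤ 2 * d * m := by positivity
      have hsum : ∑ l ∈ Finset.range (M.L - t), ENNReal.ofReal (2 * d * m) ^ (l + 1) =
          ENNReal.ofReal (∑ l ∈ Finset.range (M.L - t), (2 * d * m) ^ (l + 1)) := by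
        rw [ENNReal.ofReal_sum_of_nonneg fun l _ => by positivity]
        exact Finset.sum_congr rfl fun l _ => (ENNReal.ofReal_pow hy0 _).symm
      rw [hy, hsum, ← ENNReal.ofReal_mul hq0, ← ENNReal.ofReal_div_of_pos hc0,
        ← ENNReal.ofReal_add hq0 (by positivity)]
      refine ENNReal.ofReal_le_ofReal (add_mul_sum_pow_div_le hq0 hy0 hc0 ?_ ?_ ?_
        (Nat.sub_le _ _))
      · nlinarith
      · nlinarith
      · rw [div_le_iff₀ hc0, hc]
        -- This is `4Vd < λ√C`, the content of `k_max > 0`, combined with `√C ≤ C`.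
        have h1 : 2 * d * (20 * V) ≤ 10 * (C : ℝ) * lam := by nlinarith
        have h2 : 10 * (C * m) * (lam / (20 * V)) = m * (10 * C * lam / (20 * V)) := by ring
        rw [h2, mul_comm (2 * d) m]
        refine mul_le_mul_of_nonneg_left ?_ (by positivity)
        rwa [le_div_iff₀ (by positivity)]
    set U := ⋃ t ∈ Finset.range (n + 1), ⋃ i, Bad t i with hU
    have hUle : M.jointLaw P C s n U ≤ ENNReal.ofReal (5 * (4 * m * C) ^ (M.L + 1) * (e + δ)) := by
      refine (measure_biUnion_range_iUnion_le _ Bad hBadle).trans (ENNReal.ofReal_le_ofReal ?_)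
      exact union_bound_le he0.le hδ0 hm1 (by linarith) hn
    -- A measurable hull of the bad set has the same measure, so no measurability of the union is
    -- needed.
    refine ⟨(toMeasurable (M.jointLaw P C s n) U)ᶜ, (measurableSet_toMeasurable _ _).compl, ?_, ?_⟩
    · rw [probReal_compl_eq_one_sub (measurableSet_toMeasurable _ _)]
      have h1 : (M.jointLaw P C s n).real (toMeasurable (M.jointLaw P C s n) U) ≤
          5 * (4 * m * C) ^ (M.L + 1) * (e + δ) := by
        rw [Measure.real, measure_toMeasurable]
        exact ENNReal.toReal_le_of_le_ofReal (by positivity) hUle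
      linarith
    · intro q hqE π hπ t ht i
      have hqU : q ∉ Bad t i := fun h => hqE (subset_toMeasurable _ _
        (Set.mem_biUnion (Finset.mem_range.2 (Nat.lt_succ_of_le ht)) (Set.mem_iUnion.2 ⟨i, h⟩)))
      obtain ⟨hacc, htail⟩ := not_not.1 hqU
      have h1 := hacc.abs_QPAux_sub_QMPAux_le M g hC hR0 hR hRV hV hV0 (hrew1 q.1) (hrewR q.1)
        hlam hν hαL hα hβL hβ hε0 hε1 hεV pol π hπ (k := M.L - t) (by omega)
      have hαβt := hαβ t (ht.trans hn)
      have h2 := h1.trans (add_le_add le_rfl (mul_le_mul le_rfl htail zero_le zero_le))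
      have hsum0 : 0 ≤ α t + β t := by linarith [hαβt.1, hαβt.2]
      have h3 : 2 * V * c = 1 / 10 * lam := by rw [hc]; field_simp; ring
      rw [← ENNReal.ofReal_mul (by positivity), h3,
        ENNReal.add_le_add_iff_right ENNReal.ofReal_ne_top, ENNReal.ofReal_le_ofReal_iff hsum0] at h2
      exact h2

end POMDP

end

end PBMDP

/-! ### The theorem -/

theorem mainTheorem2
    {X A Z Ω : Type*} [MeasurableSpace X] [MeasurableSpace A] [MeasurableSpace Z]
    [MeasurableSpace Ω] (vol : Measure Z) [SigmaFinite vol]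
    (M : PBMDP.POMDP X A)
    -- original and simplified observation models
    (pZ qZ : PBMDP.ObsDensity X vol)
    -- bounded rewards
    (Rmax : ℕ → ℝ) (hR : ∀ t ≤ M.L, ∀ x a, |M.r t x a| ≤ Rmax t)
    -- bounded normalized likelihoods
    (d : ℝ) (hd : ∀ g ∈ ({pZ, qZ} : Set (PBMDP.ObsDensity X vol)), M.LikelihoodBound g d)
    -- probabilistically bounded reward estimates `rEst N`, `N` being the number of reward samples
    (P : Measure Ω) [IsProbabilityMeasure P] (rEst : ℕ → Ω → ℕ → X → A → ℝ)
    (hrm : ∀ N t, Measurable (fun q : Ω × X × A => rEst N q.1 t q.2.1 q.2.2))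
    (δr : ℝ → ℕ → ℝ)
    (hδ : ∀ ν ≥ 0, ∀ N, ∀ t ≤ M.L, ∀ x a,
      P.real {ω | ν ≤ |M.r t x a - rEst N ω t x a|} ≤ δr ν N)
    (_hδlim : ∀ ν > 0, Tendsto (δr ν) atTop (𝓝 0))
    -- parameters
    (C N : ℕ) (hC : 0 < C) (lam ν : ℝ) (hlam : 0 ≤ lam) (hν : 0 ≤ ν)
    (hk : 0 < M.kMax Rmax d lam C)
    (α β : ℕ → ℝ)
    (hαL : α M.L = lam) (hα : ∀ t < M.L, α t = (1 + M.γ) * lam + M.γ * α (t + 1))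
    (hβL : β M.L = 2 * ν) (hβ : ∀ t < M.L, β t = 2 * ν + M.γ * β (t + 1)) :
    ∀ g ∈ ({pZ, qZ} : Set (PBMDP.ObsDensity X vol)),
    -- the particle-belief MDP uses the exact reward, or the estimate if that obeys the same bound
    ∀ rew : Ω → ℕ → X → A → ℝ,
      ((rew = fun _ => M.r) ∨
        (rew = rEst N ∧ ∀ ω, ∀ t ≤ M.L, ∀ x a, |rEst N ω t x a| ≤ Rmax t)) →
    -- a history of length `n` at which the beliefs are defined
    ∀ n ≤ M.L, ∀ s : ℕ → A × Z,
      (∀ t ≤ n, M.evidence g s t ≠ 0 ∧ M.evidence g s t ≠ ∞) →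
    -- one policy
    (∀ (π : PBMDP.Policy A Z) (a : ℕ → A), ∃ E : Set (Ω × (Fin C → ℕ → X)),
      MeasurableSet E ∧
      1 - 5 * (4 * (C : ℝ)) ^ (M.L + 1) *
          (Real.exp (-(C * M.kAcute Rmax d lam C ^ 2)) + δr ν N) ≤
        (P.prod (Measure.pi fun _ : Fin C => M.pathLaw (fun i => (s i).1) n)).real E ∧
      ∀ q ∈ E, ∀ t ≤ n,
        |M.QP g π t s (a t) - M.QMP g (rew q.1) π t s q.2 (a t)| ≤ α t + β t) ∧
    -- all policies and actions simultaneously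
    (Finite A → ∃ E : Set (Ω × (Fin C → ℕ → X)),
      MeasurableSet E ∧
      1 - 5 * (4 * (Nat.card A : ℝ) * (C : ℝ)) ^ (M.L + 1) *
          (Real.exp (-(C * M.kAcute Rmax d lam C ^ 2)) + δr ν N) ≤
        (P.prod (Measure.pi fun _ : Fin C => M.pathLaw (fun i => (s i).1) n)).real E ∧
      ∀ q ∈ E, ∀ (π : PBMDP.Policy A Z), ∀ t ≤ n, ∀ a : A,
        |M.QP g π t s a - M.QMP g (rew q.1) π t s q.2 a| ≤ α t + β t) := by
  intro g hg rew hrew n hn s hs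
  have hrewm : ∀ t, Measurable fun q : Ω × X × A => rew q.1 t q.2.1 q.2.2 := by
    intro t
    rcases hrew with rfl | ⟨rfl, -⟩
    · exact (M.measurable_r t).comp measurable_snd
    · exact hrm N t
  have hrewR : ∀ ω, ∀ t ≤ M.L, ∀ x a, |rew ω t x a| ≤ Rmax t := by
    rcases hrew with rfl | ⟨rfl, h⟩
    · exact fun _ => hR
    · exact h
  have hrewδ : ∀ t ≤ M.L, ∀ x a, P.real {ω | ν ≤ |M.r t x a - rew ω t x a|} ≤ δr ν N := by
    intro t ht x a
    refine le_trans ?_ (hδ ν hν N t ht x a)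
    rcases hrew with rfl | ⟨rfl, -⟩
    -- With the exact reward the bad event is empty unless `ν = 0`, and then the bad event of the
    -- estimate is the whole space.
    · refine measureReal_mono fun ω h => ?_
      have h' : ν ≤ |M.r t x a - M.r t x a| := h
      rw [sub_self, abs_zero] at h'
      exact h'.trans (abs_nonneg _)
    · exact le_rfl
  refine ⟨fun π a => ?_, fun hA => ?_⟩
  · obtain ⟨E, hE, hP, hb⟩ := M.exists_event g P hR (hd g hg) hrewm hrewR hν hrewδ hC hlam hk hαL
      hα hβL hβ hn s hs (fun _ : Unit => π) (fun _ => a)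
    refine ⟨E, hE, ?_, fun q hq t ht => hb q hq π (fun _ _ => ⟨(), rfl⟩) t ht ()⟩
    rw [Fintype.card_unit, Nat.cast_one, mul_one] at hP
    exact hP
  · have := Fintype.ofFinite A
    have hAne : Nonempty A := ⟨(s 0).1⟩
    -- The constant policies offer every action at every history, so each policy always agrees with
    -- one of them.
    obtain ⟨E, hE, hP, hb⟩ := M.exists_event g P hR (hd g hg) hrewm hrewR hν hrewδ hC hlam hk hαL
      hα hβL hβ hn s hs (fun a : A => ⟨fun _ _ => a, fun _ => measurable_const⟩) (fun a _ => a)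
    refine ⟨E, hE, ?_, fun q hq π t ht a => hb q hq π (fun t s => ⟨π.action t s, rfl⟩) t ht a⟩
    rw [Nat.card_eq_fintype_card]
    exact hP
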